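/- All graphs are finite and may have self-loops (an edge is a set $uv=\{u,v\}$ of one or two vertices). For a graph $G$ let $G^\circ$ be $G$ with all missing self-loops added, and let $k,q\ge 1$ be integers. **Tree decompositions.** A tree decomposition of $G$ is a finite rooted tree $(T,r)$ with bags $\beta(t)\subseteq V(G)$, $t\in V(T)$, such that every vertex lies in some bag, every edge is contained in some bag, and for every vertex $v$ the nodes $t$ with $v\in\beta(t)$ induce a connected subgraph of $T$. Its width is $\max_t|\beta(t)|-1$ and its depth is $\max_t|\bigcup_{s\in P_t}\beta(s)|$, where $P_t$ is the path in $T$ from $r$ to $t$. **Pre-tree decompositions.** For $X\subseteq E(G)$ let $\delta(X)$ be the set of vertices incident both to an edge in $X$ and to an edge in $E(G)\setminus X$; for a partition $\pi$ of $E(G)$ (empty parts allowed) let $\delta(\pi)=\bigcup_{X\in\pi}\delta(X)$. A leaf of $T$ is a node with exactly one neighbour. A pre-tree decomposition of $G$ consists of a finite rooted tree $(T,r)$, bags $\beta(t)\subseteq V(G)$ and cones $\gamma(s,t)\subseteq E(G)$ for all ordered pairs of adjacent nodes such that: $\beta(r)=\emptyset$, and for every connected component $C$ of $G$ there is a child $c$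 of $r$ with $\gamma(r,c)=E(C)$; $|\gamma(t,\ell)|\le 1$ for every leaf $\ell$ with neighbour $t$; for every node $t$ the family $\pi_t$ is a partition of $E(G)$ with $\delta(\pi_t)\subseteq\beta(t)$, where $\pi_t$ consists of the cones $\gamma(t,s)$, $s\in N(t)$, if $t$ is not a leaf, and of $\gamma(t,p)$ and $E(G)\setminus\gamma(t,p)$ if $t$ is a leaf with neighbour $p$; and $\gamma(s,t)\cap\gamma(t,s)=\emptyset$ for every edge $st$ of $T$. It is exact if $\gamma(s,t)\cup\gamma(t,s)=E(G)$ for every edge $st$ of $T$ and $\beta(t)=\delta(\pi_t)$ for every node $t$. Its width is $\max_t|\beta(t)|-1$, and its depth is $\max_t\sum_{s\in P_t\setminus\{r\}}|\beta(s)\setminus\beta(p_s)|$, where $p_s$ is the parent of $s$. **The game.** For $X\subseteq V(G)$ and an edge $e$ of $G$ put $\gamma^X_e=\{e\}$ if $e\subseteq X$; otherwise let $\gamma^X_e$ be the set of all edges of $G$ incident to the connected component of $G\setminus X$ that $e$ is incident to. In the $q$-placement $k$-cops-and-robber game on $G$ a position consists of a set $X\subseteq V(G)$ of at most $k$ vertices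 (the cops), an edge $e$ (the robber), and a counter $j$. Initially $X=\emptyset$, $j=0$, and the robber chooses $e\in E(G)$; if $G$ has no edge, the cop player wins immediately. In each round the cop player moves to a set $X'\subseteq X$ or, if $j<q$, to $X'=X\cup\{v\}$ for some $v\in V(G)$, provided $|X'|\le k$, increasing $j$ by one; the robber, knowing $X'$, then moves to some edge $e'\in\gamma^{X\cap X'}_e$. If $e'\subseteq X'$, the robber is captured and the cop player wins; otherwise, if $j=q$, the robber wins; otherwise the next round begins at $X',e',j$. The cop player wins the game if the cop player can force a capture within finitely many rounds. In the monotone game the cop player may only use moves with $\gamma^{X\cap X'}_e\subseteq\gamma^X_e$. **Theorem.** Let $k,q\ge1$ and let $G$ be a graph. The following are equivalent: 1. $G$ admits a tree decomposition of width at most $k-1$ and depth at most $q$. 2. $G^\circ$ admits a tree decomposition of width at most $k-1$ and depth at most $q$. 3. $G^\circ$ admits an exact pre-tree decomposition of width at most $k-1$ and depth at most $q$. 4. The cop player wins the monotone $q$-placement $k$-cops-and-robber game on $G^\circ$. 5. The cop player wins the $q$-placement $k$-cops-and-robber game on $G^\circ$. 6. The cop player wins the monotone $q$-placement $k$-cops-and-robber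 game on $G$. 7. The cop player wins the $q$-placement $k$-cops-and-robber game on $G$. In particular, the cop player wins the $q$-placement $k$-cops-and-robber game if and only if the cop player wins its monotone version. -/

import Mathlib

open Finset

namespace CopsRobber

/-! ### Graphs with self-loops, on a fixed finite vertex set -/

/-- A graph on the vertex set `V`: its edges are unordered pairs `uv` of vertices, where `u = v`
(a self-loop) is allowed. -/
@[ext]
structure LoopGraph (V : Type*) where
  edges : Set (Sym2 V)

namespace LoopGraph

variable {V : Type*} (G : LoopGraph V)

/-- `G°`: the graph `G` with all self-loops added. -/
def addLoops : LoopGraph V where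
  edges := G.edges ∪ Set.range (fun v : V => s(v, v))

/-- The adjacency relation between distinct vertices of `G`; it determines connectivity. -/
def adj : SimpleGraph V := SimpleGraph.fromEdgeSet G.edges

/-- `E(C)`, the edges of a connected component `C` of `G`, including self-loops. -/
def componentEdges (C : G.adj.ConnectedComponent) : Set (Sym2 V) :=
  {e ∈ G.edges | ∀ v ∈ e, v ∈ C.supp}

/-- `δ(X)`: the vertices incident both to an edge in `X` and to an edge of `G` outside `X`. -/
def boundary (X : Set (Sym2 V)) : Set V :=
  {v | ∃ e ∈ X, ∃ e' ∈ G.edges \ X, v ∈ e ∧ v ∈ e'}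

end LoopGraph

/-- The family `X` is a partition of `E`; parts may be empty, also several of them. -/
def IsPartition {α ι : Type*} (E : Set α) (X : ι → Set α) : Prop :=
  (⋃ i, X i) = E ∧ Pairwise (fun i j => Disjoint (X i) (X j))

/-! ### Rooted trees -/

/-- A finite rooted tree. -/
structure RTree where
  node : Type
  [fintypeNode : Fintype node]
  [decEqNode : DecidableEq node]
  graph : SimpleGraph node
  isTree : graph.IsTree
  root : node

attribute [instance] RTree.fintypeNode RTree.decEqNode

namespace RTree

variable (T : RTree)

/-- The unique path from the root to `t`. -/
noncomputable def path (t : T.node) : T.graph.Walk T.root t :=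
  (T.isTree.existsUnique_path T.root t).choose

/-- A leaf is a node with exactly one neighbour. -/
def IsLeaf (t : T.node) : Prop := (T.graph.neighborSet t).ncard = 1

/-- The width `max_t |β(t)| - 1` of a family of bags. -/
def width {V : Type*} (β : T.node → Finset V) : ℤ :=
  ((univ.sup fun t => (β t).card : ℕ) : ℤ) - 1

end RTree

/-! ### Tree decompositions -/

section TreeDec

variable {V : Type*} [DecidableEq V]

/-- `(T, β)` is a tree decomposition of `G`. -/
structure IsTreeDec (G : LoopGraph V) (T : RTree) (β : T.node → Finset V) : Prop where
  vertex_mem : ∀ v : V, ∃ t, v ∈ β t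
  edge_mem : ∀ e ∈ G.edges, ∃ t, ∀ v ∈ e, v ∈ β t
  connected : ∀ v : V, (T.graph.induce {t | v ∈ β t}).Connected

/-- The depth of a tree decomposition: the maximal size of the union of the bags on a path from
the root. These unions grow along the path, so it makes no difference whether the maximum is taken
over all nodes or, in a tree with at least two nodes, over the leaves only. -/
noncomputable def treeDecDepth (T : RTree) (β : T.node → Finset V) : ℕ :=
  univ.sup fun t => ((T.path t).support.toFinset.biUnion β).card

/-- `G` admits a tree decomposition of width at most `k - 1` and depth at most `q`. -/
def HasTreeDec (G : LoopGraph V) (k q : ℕ) : Prop :=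
  ∃ (T : RTree) (β : T.node → Finset V),
    IsTreeDec G T β ∧ T.width β ≤ (k : ℤ) - 1 ∧ treeDecDepth T β ≤ q

/-! ### Pre-tree decompositions -/

open Classical in
/-- The family `π_t`. At an inner node `t` it consists of the cones `γ(t, s)` at the neighbours `s`
of `t` (the additional index `none` carries an empty part); at a leaf `t` with neighbour `p` it
consists of `γ(t, p)` and its complement in `E(G)`. -/
noncomputable def partitionAt (G : LoopGraph V) (T : RTree)
    (γ : T.node → T.node → Set (Sym2 V)) (t : T.node) :
    Option (T.graph.neighborSet t) → Set (Sym2 V)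
  | some s => γ t s
  | none => if T.IsLeaf t then G.edges \ ⋃ s : T.graph.neighborSet t, γ t s else ∅

/-- `δ(π_t)`. -/
def partitionBoundary (G : LoopGraph V) (T : RTree)
    (γ : T.node → T.node → Set (Sym2 V)) (t : T.node) : Set V :=
  {v | ∃ i, v ∈ G.boundary (partitionAt G T γ t i)}

/-- `(T, β, γ)` is a rooted pre-tree decomposition of `G`. Only the values `γ s t` at pairs of
adjacent nodes matter. -/
structure IsPreTreeDec (G : LoopGraph V) (T : RTree) (β : T.node → Finset V)
    (γ : T.node → T.node → Set (Sym2 V)) : Prop where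
  root_bag : β T.root = ∅
  root_cone : ∀ C : G.adj.ConnectedComponent,
    ∃ c, T.graph.Adj T.root c ∧ γ T.root c = G.componentEdges C
  leaf_cone : ∀ l t, T.IsLeaf l → T.graph.Adj t l → (γ t l).encard ≤ 1
  partition : ∀ t, IsPartition G.edges (partitionAt G T γ t)
  boundary_subset : ∀ t, partitionBoundary G T γ t ⊆ (β t : Set V)
  disjoint : ∀ s t, T.graph.Adj s t → Disjoint (γ s t) (γ t s)

/-- Exactness of a pre-tree decomposition. -/
structure IsExact (G : LoopGraph V) (T : RTree) (β : T.node → Finset V)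
    (γ : T.node → T.node → Set (Sym2 V)) : Prop where
  edge_exact : ∀ s t, T.graph.Adj s t → γ s t ∪ γ t s = G.edges
  bag_exact : ∀ t, (β t : Set V) = partitionBoundary G T γ t

/-- The depth of a pre-tree decomposition: the maximum over all nodes `t` of the sum of
`|β(s) \ β(p_s)|` over the nodes `s` other than the root on the path from the root to `t`, where
`p_s` is the parent of `s`. The darts of that path are exactly the pairs `(p_s, s)`. -/
noncomputable def preTreeDecDepth (T : RTree) (β : T.node → Finset V) : ℕ :=
  univ.sup fun t => ((T.path t).darts.map fun d => (β d.snd \ β d.fst).card).sum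

/-- `G` admits an exact pre-tree decomposition of width at most `k - 1` and depth at most `q`. -/
def HasExactPreTreeDec (G : LoopGraph V) (k q : ℕ) : Prop :=
  ∃ (T : RTree) (β : T.node → Finset V) (γ : T.node → T.node → Set (Sym2 V)),
    IsPreTreeDec G T β γ ∧ IsExact G T β γ ∧
      T.width β ≤ (k : ℤ) - 1 ∧ preTreeDecDepth T β ≤ q

/-! ### The cops-and-robber game -/

/-- The graph `G \ X`. -/
def LoopGraph.delete (G : LoopGraph V) (X : Finset V) : SimpleGraph {v : V // v ∉ X} :=
  G.adj.induce {v | v ∉ X}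

/-- The edges of the edge component given by a connected component `C` of `G \ X`: the edges
inside `C` together with the edges between `C` and `X`. -/
def LoopGraph.edgesAt (G : LoopGraph V) (X : Finset V) (C : (G.delete X).ConnectedComponent) :
    Set (Sym2 V) :=
  {f ∈ G.edges | ∃ w ∈ C.supp, (w : V) ∈ f}

/-- `γ^X_e`: the edges of the component of the edge component graph `G^X` that contains the edge
`e`. It is `{e}` if both ends of `e` are in `X`, and otherwise the set of the edges that are
incident to the connected component of `G \ X` that `e` is incident to. -/
def LoopGraph.escape (G : LoopGraph V) (X : Finset V) (e : Sym2 V) : Set (Sym2 V) :=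
  {f ∈ G.edges | f = e ∨ ∃ C : (G.delete X).ConnectedComponent,
    e ∈ G.edgesAt X C ∧ f ∈ G.edgesAt X C}

/-- The robber on the edge `f` is captured by cops on `X`. -/
def Captured (X : Finset V) (f : Sym2 V) : Prop := ∀ v ∈ f, v ∈ X

/-- `CopMove k q X j X' j'`: from the cop position `X` with `j` placements made so far, the cop
player may go to `X'`, and then `j'` placements have been made. -/
inductive CopMove (k q : ℕ) : Finset V → ℕ → Finset V → ℕ → Prop
  | remove {X X' : Finset V} {j : ℕ} (h : X' ⊆ X) : CopMove k q X j X' j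
  | place {X : Finset V} {j : ℕ} (v : V) (hj : j < q) (hk : (insert v X).card ≤ k) :
      CopMove k q X j (insert v X) (j + 1)

/-- `WinsFrom G mono k q X e j`: with cops on `X`, the robber on the edge `e`, not captured, and
counter `j`, the cop player can force the capture of the robber within finitely many rounds. In a
round the cop player announces a move from `X` to `X'`, then the robber goes to any edge in
`γ^{X ∩ X'}_e`. If the robber is then not captured, the game is lost for the cop player when the
counter is `q`, and goes on otherwise. If `mono` holds, only monotone cop moves are allowed. -/
inductive WinsFrom (G : LoopGraph V) (mono : Prop) (k q : ℕ) : Finset V → Sym2 V → ℕ → Prop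
  | round {X : Finset V} {e : Sym2 V} {j : ℕ} (X' : Finset V) (j' : ℕ)
      (move : CopMove k q X j X' j')
      (monotone : mono → G.escape (X ∩ X') e ⊆ G.escape X e)
      (not_lost : ∀ f ∈ G.escape (X ∩ X') e, ¬ Captured X' f → j' ≠ q)
      (next : ∀ f ∈ G.escape (X ∩ X') e, ¬ Captured X' f → WinsFrom G mono k q X' f j') :
      WinsFrom G mono k q X e j

/-- The cop player wins the `q`-placement `k`-cops-and-robber game on `G`: whichever edge the
robber starts on, the cop player wins starting without cops. (If `G` has no edge, the cop player
wins immediately.) -/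
def CopsWin (G : LoopGraph V) (k q : ℕ) : Prop :=
  ∀ e ∈ G.edges, WinsFrom G False k q ∅ e 0

/-- The cop player wins the monotone `q`-placement `k`-cops-and-robber game on `G`. -/
def CopsWinMonotone (G : LoopGraph V) (k q : ℕ) : Prop :=
  ∀ e ∈ G.edges, WinsFrom G True k q ∅ e 0

end TreeDec

end CopsRobber

/-! The easy implications turn decompositions into strategies. With the robber confined below a
child `s` of `t`, the cops go from the bag of `t` to the bag of `s`, placing only the vertices of
the second bag outside the first. The sums of these numbers along root paths are bounded by the
depth. For tree decompositions this strategy is monotone (`IsTreeDec.forces`,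
`IsPreTreeDec.forces`). Self-loops do not affect the existence of tree decompositions, and in the
game a robber on a loop is shadowed by a robber on an incident edge (`Forces.addLoops`).

The substance is that an arbitrary, possibly non-monotone, winning strategy on a graph with all
loops yields a decomposition. The edges are distributed over the leaves of a growing tree; each leaf
remembers a game position whose robber region contains its edges. A leaf with edge set `A` and at
least two edges is split by the next cop move, from `X` to `X'` plus `v`. The robber region `R` of
`X'` contains `A`, and properly so if the move is not monotone. Among all `F` with `A ⊆ F ⊆ R` one
of least boundary is chosen; its edges are pulled into the leaf, also from other leaves, and then
separated along the components of the new position (`IsPartialDec.step`).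

Submodularity of boundaries (`ncard_splitVertices_le`) is used twice. Minimality of `F` against
smaller sets shows that no bag or path union elsewhere grows; minimality against `R` shows that the
new bag has at most as many vertices as `X'` plus `v`. Thanks to the loops, the path union gains at
most the vertex `v`, so depth counts placements. When the placements are used up, every leaf carries
one edge. The resulting tree gives both an exact pre-tree decomposition and, with the ends of the
leaf edges added to the bags, a tree decomposition. -/

namespace CopsRobber

variable {V : Type*}

/-! ### Edge components -/

namespace LoopGraph

/-- `u` and `w` lie in the same connected component of `G \ X`. -/
def Linked (G : LoopGraph V) (X : Finset V) (u w : V) : Prop :=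
  ∃ (hu : u ∉ X) (hw : w ∉ X), (G.delete X).Reachable ⟨u, hu⟩ ⟨w, hw⟩

variable {G : LoopGraph V} {X Y : Finset V} {u v w : V} {e f g : Sym2 V} {C : Set (Sym2 V)}

theorem Linked.left (h : G.Linked X u w) : u ∉ X := h.1

theorem Linked.right (h : G.Linked X u w) : w ∉ X := h.2.1

theorem Linked.refl (h : u ∉ X) : G.Linked X u u := ⟨h, h, SimpleGraph.Reachable.refl _⟩

theorem Linked.symm (h : G.Linked X u w) : G.Linked X w u :=
  ⟨h.2.1, h.1, h.2.2.symm⟩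

theorem Linked.trans (h : G.Linked X u v) (h' : G.Linked X v w) : G.Linked X u w :=
  ⟨h.1, h'.2.1, h.2.2.trans h'.2.2⟩

theorem Linked.of_mem_edge (he : e ∈ G.edges) (hu : u ∈ e) (hw : w ∈ e) (huX : u ∉ X)
    (hwX : w ∉ X) : G.Linked X u w := by
  by_cases h : u = w
  · subst h; exact .refl huX
  · refine ⟨huX, hwX, SimpleGraph.Adj.reachable ?_⟩
    have : e = s(u, w) := ((Sym2.mem_and_mem_iff h).1 ⟨hu, hw⟩)
    simp only [delete, adj, SimpleGraph.comap_adj, SimpleGraph.fromEdgeSet_adj,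
      Function.Embedding.subtype_apply]
    exact ⟨this ▸ he, h⟩

/-- A property of vertices which is inherited along the edges avoiding `X` spreads over a connected
component of `G \ X`. -/
theorem Linked.induction (P : V → Prop) (h : G.Linked X u w) (hu : P u)
    (step : ∀ a b, a ∉ X → b ∉ X → s(a, b) ∈ G.edges → P a → P b) : P w := by
  obtain ⟨hu', hw', ⟨p⟩⟩ := h
  suffices H : ∀ a b : {v : V // v ∉ X}, (G.delete X).Walk a b → P a → P b from H _ _ p hu
  intro a b p
  induction p with
  | nil => exact id
  | @cons a b c hab p ih =>
    intro ha
    refine ih (step a b a.2 b.2 ?_ ha)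
    simp only [delete, adj, SimpleGraph.comap_adj, SimpleGraph.fromEdgeSet_adj,
      Function.Embedding.subtype_apply] at hab
    exact hab.1

theorem Linked.anti (h : G.Linked X u w) (hYX : Y ⊆ X) : G.Linked Y u w :=
  h.induction (G.Linked Y u ·) (.refl fun hu => h.left (hYX hu)) fun _ _ ha hb hab hua =>
    hua.trans (.of_mem_edge hab (Sym2.mem_mk_left _ _) (Sym2.mem_mk_right _ _)
      (fun h => ha (hYX h)) (fun h => hb (hYX h)))

theorem mem_escape : f ∈ G.escape X e ↔
    f ∈ G.edges ∧ (f = e ∨ e ∈ G.edges ∧ ∃ u ∈ e, ∃ w ∈ f, G.Linked X u w) := by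
  constructor
  · rintro ⟨hf, rfl | ⟨C, ⟨he, u, hu, hue⟩, -, w, hw, hwf⟩⟩
    · exact ⟨hf, .inl rfl⟩
    · refine ⟨hf, .inr ⟨he, u, hue, w, hwf, u.2, w.2, ?_⟩⟩
      rw [SimpleGraph.ConnectedComponent.mem_supp_iff] at hu hw
      exact SimpleGraph.ConnectedComponent.exact (hu.trans hw.symm)
  · rintro ⟨hf, rfl | ⟨he, u, hu, w, hw, hu', hw', h⟩⟩
    · exact ⟨hf, .inl rfl⟩
    · exact ⟨hf, .inr ⟨(G.delete X).connectedComponentMk ⟨u, hu'⟩,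
        ⟨he, ⟨u, hu'⟩, rfl, hu⟩, hf, ⟨w, hw'⟩, SimpleGraph.ConnectedComponent.sound h.symm, hw⟩⟩

theorem escape_subset : G.escape X e ⊆ G.edges := fun _ h => h.1

theorem self_mem_escape (he : e ∈ G.edges) : e ∈ G.escape X e := mem_escape.2 ⟨he, .inl rfl⟩

theorem mem_escape_of_mem (he : e ∈ G.edges) (hf : f ∈ G.edges) (hve : v ∈ e) (hvf : v ∈ f)
    (hv : v ∉ X) : f ∈ G.escape X e :=
  mem_escape.2 ⟨hf, .inr ⟨he, v, hve, v, hvf, .refl hv⟩⟩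

theorem mem_escape_comm (he : e ∈ G.edges) (h : f ∈ G.escape X e) : e ∈ G.escape X f := by
  obtain ⟨hf, rfl | ⟨-, u, hu, w, hw, huw⟩⟩ := mem_escape.1 h
  · exact h
  · exact mem_escape.2 ⟨he, .inr ⟨hf, w, hw, u, hu, huw.symm⟩⟩

/-- A set of edges whose boundary is guarded by `X` is not left by the robber. -/
theorem escape_subset_of_boundary (hX : G.boundary C ⊆ (X : Set V))
    (he : e ∈ C) : G.escape X e ⊆ C := by
  intro f hf
  obtain ⟨hf, rfl | ⟨-, u, hu, w, hw, huw⟩⟩ := mem_escape.1 hf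
  · exact he
  have key : ∀ v ∉ X, (∃ g ∈ C, v ∈ g) → ∀ g ∈ G.edges, v ∈ g → g ∈ C := by
    rintro v hv ⟨g, hg, hvg⟩ g' hg' hvg'
    by_contra hn
    exact hv (hX ⟨g, hg, g', ⟨hg', hn⟩, hvg, hvg'⟩)
  refine key w huw.right ?_ f hf hw
  refine huw.induction (fun v => ∃ g ∈ C, v ∈ g) ⟨e, he, hu⟩ ?_
  intro a b ha _ hab h
  exact ⟨_, key a ha h _ hab (Sym2.mem_mk_left _ _), Sym2.mem_mk_right _ _⟩

/-- With `escape_subset_of_boundary` this makes `escape X e` the least edge set containing `e` whose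
boundary lies in `X`, so robber regions can be compared through boundaries alone. -/
theorem boundary_escape_subset (he : e ∈ G.edges) : G.boundary (G.escape X e) ⊆ (X : Set V) := by
  rintro v ⟨f, hf, f', ⟨hf', hn⟩, hvf, hvf'⟩
  by_contra hv
  refine hn ?_
  obtain ⟨hf, rfl | ⟨-, u, hu, w, hw, huw⟩⟩ := mem_escape.1 hf
  · exact mem_escape_of_mem he hf' hvf hvf' hv
  · exact mem_escape.2 ⟨hf', .inr ⟨he, u, hu, v, hvf',
      huw.trans (.of_mem_edge hf hw hvf huw.right hv)⟩⟩

theorem escape_subset_escape (he : e ∈ G.edges) (hf : f ∈ G.escape X e) :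
    G.escape X f ⊆ G.escape X e :=
  escape_subset_of_boundary (boundary_escape_subset he) hf

theorem escape_eq_escape (he : e ∈ G.edges) (hf : f ∈ G.escape X e) :
    G.escape X f = G.escape X e :=
  (escape_subset_escape he hf).antisymm
    (escape_subset_escape hf.1 (mem_escape_comm he hf))

theorem escape_anti (hYX : Y ⊆ X) : G.escape X e ⊆ G.escape Y e := by
  intro f hf
  obtain ⟨hf, rfl | ⟨he, u, hu, w, hw, huw⟩⟩ := mem_escape.1 hf
  · exact mem_escape.2 ⟨hf.1, .inl rfl⟩
  · exact mem_escape.2 ⟨hf, .inr ⟨he, u, hu, w, hw, huw.anti hYX⟩⟩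

theorem eq_of_mem_escape_of_captured (h : f ∈ G.escape X e) (hf : Captured X f) : f = e := by
  obtain ⟨-, h | ⟨-, u, -, w, hw, huw⟩⟩ := mem_escape.1 h
  · exact h
  · exact absurd (hf w hw) huw.right

theorem eq_of_mem_escape_of_captured_left (h : f ∈ G.escape X e) (he : Captured X e) : f = e := by
  obtain ⟨-, h | ⟨-, u, hu, w, -, huw⟩⟩ := mem_escape.1 h
  · exact h
  · exact absurd (he u hu) huw.left

theorem boundary_compl (hC : C ⊆ G.edges) : G.boundary (G.edges \ C) = G.boundary C := by
  ext v
  constructor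
  · rintro ⟨e, he, e', ⟨he', hn⟩, h, h'⟩
    exact ⟨e', by simpa [he'] using hn, e, he, h', h⟩
  · rintro ⟨e, he, e', he', h, h'⟩
    exact ⟨e', he', e, ⟨hC he, fun h => h.2 he⟩, h', h⟩

theorem addLoops_adj (G : LoopGraph V) : G.addLoops.adj = G.adj := by
  ext u v
  simp only [adj, addLoops, SimpleGraph.fromEdgeSet_adj, Set.mem_union, Set.mem_range,
    Sym2.eq_iff]
  constructor
  · rintro ⟨h | ⟨w, ⟨rfl, rfl⟩ | ⟨rfl, rfl⟩⟩, hn⟩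
    · exact ⟨h, hn⟩
    · exact absurd rfl hn
    · exact absurd rfl hn
  · rintro ⟨h, hn⟩
    exact ⟨.inl h, hn⟩

theorem linked_addLoops : G.addLoops.Linked X u w ↔ G.Linked X u w := by
  simp only [Linked, delete, addLoops_adj]

theorem loop_mem_addLoops (G : LoopGraph V) (v : V) : s(v, v) ∈ G.addLoops.edges :=
  .inr ⟨v, rfl⟩

end LoopGraph

theorem not_captured_empty (e : Sym2 V) : ¬ Captured (∅ : Finset V) e := fun h => by
  induction e with
  | _ u v => simpa using h u (Sym2.mem_mk_left _ _)

theorem Captured.mono {X Y : Finset V} {e : Sym2 V} (h : Captured X e) (hXY : X ⊆ Y) :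
    Captured Y e := fun v hv => hXY (h v hv)

/-! ### A normal form of the game -/

variable [DecidableEq V]

/-- The cop player, with cops on `X` and the robber on `e`, can capture the robber with at most `b`
further placements, where the removals between two placements are made in one go. -/
def Forces (G : LoopGraph V) (mono : Prop) (k : ℕ) : ℕ → Finset V → Sym2 V → Prop
  | 0, X, e => Captured X e
  | b + 1, X, e => Captured X e ∨ ∃ X' ⊆ X, ∃ v, (insert v X').card ≤ k ∧
      (mono → G.escape X' e ⊆ G.escape X e) ∧
      ∀ f ∈ G.escape X' e, Forces G mono k b (insert v X') f

section Forces

variable {G : LoopGraph V} {mono : Prop} {k q b : ℕ} {X Y Z W : Finset V} {e : Sym2 V}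

theorem Forces.of_captured (h : Captured X e) : Forces G mono k b X e := by
  cases b with
  | zero => exact h
  | succ b => exact .inl h

theorem Forces.succ (h : Forces G mono k b X e) : Forces G mono k (b + 1) X e := by
  induction b generalizing X e with
  | zero => exact .inl h
  | succ b ih =>
    obtain h | ⟨X', hX', v, hv, hm, h⟩ := h
    · exact .inl h
    · exact .inr ⟨X', hX', v, hv, hm, fun f hf => ih (h f hf)⟩

theorem Forces.mono_budget {b' : ℕ} (h : Forces G mono k b X e) (hb : b ≤ b') :
    Forces G mono k b' X e := by
  induction hb with
  | refl => exact h
  | step _ ih => exact ih.succ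

theorem Forces.of_subset (h : Forces G mono k b Y e) (hYX : Y ⊆ X)
    (hm : mono → G.escape Y e ⊆ G.escape X e) : Forces G mono k b X e := by
  cases b with
  | zero => exact Captured.mono h hYX
  | succ b =>
    obtain h | ⟨X', hX', v, hv, hm', h⟩ := h
    · exact .inl (h.mono hYX)
    · exact .inr ⟨X', hX'.trans hYX, v, hv, fun h => (hm' h).trans (hm h), h⟩

/-- The missing cops of `W` are added one at a time without removals. The boundary of `C` stays
guarded, so the robber stays in `C`, and each single placement is trivially monotone. -/
theorem Forces.place {C : Set (Sym2 V)} (hY : G.boundary C ⊆ (Y : Set V))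
    (hk : (Y ∪ W).card ≤ k) (h : ∀ f ∈ C, Forces G mono k b (Y ∪ W) f) (he : e ∈ C) :
    Forces G mono k (b + (W \ Y).card) Y e := by
  induction hn : (W \ Y).card generalizing Y e with
  | zero =>
    rw [Finset.card_eq_zero, Finset.sdiff_eq_empty_iff_subset] at hn
    rw [Finset.union_eq_left.2 hn] at h
    exact h e he
  | succ n ih =>
    obtain ⟨v, hv⟩ : (W \ Y).Nonempty := by
      rw [← Finset.card_pos]; omega
    rw [Finset.mem_sdiff] at hv
    have hU : insert v Y ∪ W = Y ∪ W := by
      rw [Finset.insert_union, Finset.insert_eq_self]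
      exact Finset.mem_union_right _ hv.1
    have hcard : (W \ insert v Y).card = n := by
      have : W \ insert v Y = (W \ Y).erase v := by
        ext x; simp only [Finset.mem_sdiff, Finset.mem_insert, Finset.mem_erase]; tauto
      rw [this, Finset.card_erase_of_mem (Finset.mem_sdiff.2 hv)]; omega
    refine .inr ⟨Y, subset_rfl, v, ?_, fun _ => subset_rfl, fun f hf => ?_⟩
    · refine (Finset.card_le_card ?_).trans hk
      rw [← hU]; exact Finset.subset_union_left
    · refine ih (Y := insert v Y) ?_ (by rwa [hU]) (by rwa [hU])
        (LoopGraph.escape_subset_of_boundary hY he hf) hcard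
      exact hY.trans (by simp)

/-- The cop player moves from `X` to `Z` while the robber is confined to `C`. -/
theorem Forces.move {C : Set (Sym2 V)} (hX : G.boundary C ⊆ (X : Set V))
    (hZ : G.boundary C ⊆ (Z : Set V)) (hk : Z.card ≤ k) (h : ∀ f ∈ C, Forces G mono k b Z f)
    (he : e ∈ C) (hm : mono → G.escape (X ∩ Z) e ⊆ G.escape X e) :
    Forces G mono k (b + (Z \ X).card) X e := by
  have hU : X ∩ Z ∪ Z = Z := Finset.union_eq_right.2 Finset.inter_subset_right
  -- The removals come first: `X ∩ Z` still guards the boundary of `C`, and only `Z \ X` remains to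
  -- be placed.
  have := Forces.place (Y := X ∩ Z) (W := Z) (k := k)
    (by rw [Finset.coe_inter]; exact Set.subset_inter hX hZ) (by rwa [hU]) (by rwa [hU]) he
  have hs : Z \ (X ∩ Z) = Z \ X := by
    ext x; simp only [Finset.mem_sdiff, Finset.mem_inter]; tauto
  rw [hs] at this
  exact this.of_subset Finset.inter_subset_left hm

/-- A move of the normal form becomes a removal round followed by a placement round. The robber
moves twice, but both moves stay in `escape X' e`. -/
theorem Forces.winsFrom (he : e ∈ G.edges) (hn : ¬ Captured X e) (hb : b ≤ q)
    (h : Forces G mono k b X e) : WinsFrom G mono k q X e (q - b) := by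
  induction b generalizing X e with
  | zero => exact absurd h hn
  | succ b ih =>
    obtain h | ⟨X', hX', v, hv, hm, h⟩ := h
    · exact absurd h hn
    have hXX : X ∩ X' = X' := Finset.inter_eq_right.2 hX'
    refine .round X' (q - (b + 1)) (.remove hX') (by rwa [hXX]) (fun _ _ _ => by omega) ?_
    intro f hf _
    rw [hXX] at hf
    have hXv : X' ∩ insert v X' = X' := Finset.inter_eq_left.2 (Finset.subset_insert _ _)
    refine .round (insert v X') (q - (b + 1) + 1) (.place v (by omega) hv) (by simp [hXv]) ?_ ?_
    · intro g hg hgn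
      rw [hXv] at hg
      have := h g (LoopGraph.escape_subset_escape he hf hg)
      cases b with
      | zero => exact absurd this hgn
      | succ b => omega
    · intro g hg hgn
      rw [hXv] at hg
      have hs : q - (b + 1) + 1 = q - b := by omega
      rw [hs]
      exact ih hg.1 hgn (by omega) (h g (LoopGraph.escape_subset_escape he hf hg))

/-- In a removal round the robber may stay on `e`, so the induction hypothesis at `e` suffices, and
the removal is absorbed by `Forces.of_subset`. -/
theorem WinsFrom.forces {j : ℕ} (h : WinsFrom G mono k q X e j) (he : e ∈ G.edges)
    (hn : ¬ Captured X e) : Forces G False k (q - j) X e := by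
  induction h with
  | @round X e j X' j' move _ _ next ih =>
    cases move with
    | remove hX' =>
      rw [Finset.inter_eq_right.2 hX'] at ih
      have hn' : ¬ Captured X' e := fun h => hn (h.mono hX')
      exact (ih e (LoopGraph.self_mem_escape he) hn' he hn').of_subset hX' False.elim
    | place v hj hk =>
      rw [Finset.inter_eq_left.2 (Finset.subset_insert v X)] at ih
      have hs : q - j = q - (j + 1) + 1 := by omega
      rw [hs]
      refine .inr ⟨X, subset_rfl, v, hk, False.elim, fun f hf => ?_⟩
      by_cases hc : Captured (insert v X) f
      · exact .of_captured hc
      · exact ih f hf hc hf.1 hc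

theorem WinsFrom.nonmonotone {j : ℕ} (h : WinsFrom G mono k q X e j) :
    WinsFrom G False k q X e j := by
  induction h with
  | round X' j' move _ not_lost _ ih => exact .round X' j' move False.elim not_lost ih

end Forces

theorem copsWin_iff_forces {G : LoopGraph V} {k q : ℕ} :
    CopsWin G k q ↔ ∀ e ∈ G.edges, Forces G False k q ∅ e := by
  refine ⟨fun h e he => (h e he).forces he (not_captured_empty e), fun h e he => ?_⟩
  simpa using (h e he).winsFrom he (not_captured_empty e) le_rfl

theorem copsWinMonotone_of_forces {G : LoopGraph V} {k q : ℕ}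
    (h : ∀ e ∈ G.edges, Forces G True k q ∅ e) : CopsWinMonotone G k q := fun e he => by
  simpa using (h e he).winsFrom he (not_captured_empty e) le_rfl

theorem CopsWinMonotone.copsWin {G : LoopGraph V} {k q : ℕ} (h : CopsWinMonotone G k q) :
    CopsWin G k q := fun e he => (h e he).nonmonotone

/-! ### Adding loops -/

/-- Every robber move on `G°` is shadowed by a move on `G`: a loop reached at `w` is replaced by an
edge of `G` through `w`. Capturing the shadow captures the loop. -/
theorem Forces.addLoops {G : LoopGraph V} {k b : ℕ} {X : Finset V} {e e' : Sym2 V}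
    (h : Forces G False k b X e) (he : e ∈ G.edges) (hee' : e' = e ∨ ∃ v ∈ e, e' = s(v, v)) :
    Forces G.addLoops False k b X e' := by
  have hsub : ∀ v ∈ e', v ∈ e := by
    rintro v hv
    obtain rfl | ⟨w, hw, rfl⟩ := hee'
    · exact hv
    · simp only [Sym2.mem_iff, or_self] at hv; rwa [hv]
  induction b generalizing X e e' with
  | zero => exact fun v hv => h v (hsub v hv)
  | succ b ih =>
    obtain h | ⟨X', hX', v, hv, -, h⟩ := h
    · exact .inl fun v hv => h v (hsub v hv)
    refine .inr ⟨X', hX', v, hv, False.elim, fun f' hf' => ?_⟩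
    suffices H : ∃ f ∈ G.escape X' e, f' = f ∨ ∃ v ∈ f, f' = s(v, v) by
      obtain ⟨f, hf, hff'⟩ := H
      refine ih (h f hf) hf.1 hff' ?_
      rintro w hw
      obtain rfl | ⟨w', hw', rfl⟩ := hff'
      · exact hw
      · simp only [Sym2.mem_iff, or_self] at hw; rwa [hw]
    obtain ⟨hf', rfl | ⟨-, u, hu, w, hw, huw⟩⟩ := LoopGraph.mem_escape.1 hf'
    · exact ⟨e, LoopGraph.self_mem_escape he, hee'⟩
    rw [LoopGraph.linked_addLoops] at huw
    obtain hf' | ⟨w', rfl⟩ := hf'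
    · exact ⟨f', LoopGraph.mem_escape.2 ⟨hf', .inr ⟨he, u, hsub u hu, w, hw, huw⟩⟩, .inl rfl⟩
    simp only [Sym2.mem_iff, or_self] at hw
    subst hw
    obtain ⟨f, hf, hwf⟩ : ∃ f ∈ G.edges, w ∈ f :=
      huw.induction (fun w => ∃ f ∈ G.edges, w ∈ f) ⟨e, he, hsub u hu⟩
        fun a b _ _ hab _ => ⟨_, hab, Sym2.mem_mk_right _ _⟩
    exact ⟨f, LoopGraph.mem_escape.2 ⟨hf, .inr ⟨he, u, hsub u hu, w, hwf, huw⟩⟩,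
      .inr ⟨w, hwf, rfl⟩⟩

/-- An edge which meets no other edge is captured by a single cop, if it is a loop. -/
theorem Forces.of_isolated {G : LoopGraph V} {k q : ℕ} (hk : 1 ≤ k) (hq : 1 ≤ q) {v : V}
    (hv : s(v, v) ∈ G.edges) (h : ∀ f ∈ G.edges, v ∈ f → f = s(v, v)) :
    Forces G False k q ∅ s(v, v) := by
  obtain ⟨q, rfl⟩ : ∃ r, q = r + 1 := ⟨q - 1, by omega⟩
  refine .inr ⟨∅, subset_rfl, v, by simpa using hk, False.elim, fun f hf => .of_captured ?_⟩
  have : f = s(v, v) := by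
    refine LoopGraph.escape_subset_of_boundary (C := {s(v, v)}) ?_ rfl hf
    rintro w ⟨e, rfl, e', ⟨he', hne⟩, hw, hw'⟩
    simp only [Sym2.mem_iff, or_self] at hw
    subst hw
    exact absurd (h e' he' hw') hne
  subst this
  intro w hw
  simpa using hw

theorem CopsWin.addLoops {G : LoopGraph V} {k q : ℕ} (hk : 1 ≤ k) (hq : 1 ≤ q)
    (h : CopsWin G k q) : CopsWin G.addLoops k q := by
  rw [copsWin_iff_forces] at h ⊢
  rintro e (he | ⟨v, rfl⟩)
  · exact (h e he).addLoops he (.inl rfl)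
  · by_cases hv : ∃ f ∈ G.edges, v ∈ f
    · obtain ⟨f, hf, hvf⟩ := hv
      exact (h f hf).addLoops hf (.inr ⟨v, hvf, rfl⟩)
    · refine .of_isolated hk hq (G.loop_mem_addLoops v) ?_
      rintro f (hf | ⟨w, rfl⟩) hvf
      · exact absurd ⟨f, hf, hvf⟩ hv
      · simp only [Sym2.mem_iff, or_self] at hvf; rw [hvf]

end CopsRobber

namespace CopsRobber

/-! ### Rooted trees -/

namespace RTree

variable {T : RTree} {a b s t u : T.node}

theorem path_isPath (T : RTree) (t : T.node) : (T.path t).IsPath :=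
  (T.isTree.existsUnique_path T.root t).choose_spec.1

theorem eq_path {p : T.graph.Walk T.root t} (hp : p.IsPath) : p = T.path t :=
  (T.isTree.existsUnique_path T.root t).choose_spec.2 p hp

theorem path_root (T : RTree) : T.path T.root = SimpleGraph.Walk.nil :=
  (eq_path SimpleGraph.Walk.IsPath.nil).symm

/-- `s` is a child of `t`. -/
def IsChild (T : RTree) (t s : T.node) : Prop :=
  ∃ h : T.graph.Adj t s, T.path s = (T.path t).concat h

theorem isChild_of_notMem (h : T.graph.Adj t s) (hs : s ∉ (T.path t).support) : T.IsChild t s :=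
  ⟨h, (eq_path ((T.path_isPath t).concat hs h)).symm⟩

theorem IsChild.notMem (h : T.IsChild t s) : s ∉ (T.path t).support := by
  obtain ⟨h, hp⟩ := h
  have := T.path_isPath s
  rw [hp, SimpleGraph.Walk.concat_isPath_iff] at this
  exact this.2

theorem IsChild.mem_support (h : T.IsChild t s) :
    u ∈ (T.path s).support ↔ u ∈ (T.path t).support ∨ u = s := by
  obtain ⟨h, hp⟩ := h
  rw [hp, SimpleGraph.Walk.support_concat]
  simp

theorem isChild_or_isChild (h : T.graph.Adj t s) : T.IsChild t s ∨ T.IsChild s t := by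
  by_cases hs : s ∈ (T.path t).support
  · refine .inr (isChild_of_notMem h.symm fun ht => ?_)
    have h1 := eq_path ((T.path_isPath t).takeUntil hs)
    have h2 := SimpleGraph.Walk.length_takeUntil_lt_length hs h.ne'
    have h3 := eq_path ((T.path_isPath s).takeUntil ht)
    have h4 := SimpleGraph.Walk.length_takeUntil_lt_length ht h.ne
    rw [h1] at h2
    rw [h3] at h4
    omega
  · exact .inl (isChild_of_notMem h hs)

theorem IsChild.unique (h : T.IsChild t s) (h' : T.IsChild u s) : t = u := by
  obtain ⟨h, hp⟩ := h
  obtain ⟨h', hp'⟩ := h'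
  exact (SimpleGraph.Walk.concat_inj (hp.symm.trans hp')).1

theorem induction_on {P : T.node → Prop} (t : T.node) (root : P T.root)
    (child : ∀ t s, T.IsChild t s → P t → P s) : P t := by
  suffices H : ∀ n, ∀ t, (T.path t).length = n → P t from H _ t rfl
  intro n
  induction n with
  | zero =>
    intro t ht
    obtain rfl := SimpleGraph.Walk.eq_of_length_eq_zero ht
    exact root
  | succ n ih =>
    intro t ht
    have hn : ¬ (T.path t).Nil := fun h => by
      rw [← SimpleGraph.Walk.length_eq_zero_iff] at h; omega
    have hadj := (T.path t).adj_penultimate hn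
    have hp : (T.path t).dropLast = T.path _ := eq_path (T.path_isPath t).dropLast
    have hc : T.IsChild (T.path t).penultimate t :=
      ⟨hadj, by rw [← hp, SimpleGraph.Walk.concat_dropLast]⟩
    refine child _ _ hc (ih _ ?_)
    obtain ⟨_, h⟩ := hc
    have := congrArg SimpleGraph.Walk.length h
    rw [SimpleGraph.Walk.length_concat] at this
    omega

theorem leaves_induction {P : T.node → Prop} (t : T.node)
    (step : ∀ t, (∀ s, T.IsChild t s → P s) → P t) : P t := by
  suffices H : ∀ n, ∀ t, Fintype.card T.node ≤ (T.path t).length + n → P t from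
    H (Fintype.card T.node) t (by omega)
  intro n
  induction n with
  | zero =>
    intro t ht
    have := (T.path_isPath t).length_lt
    omega
  | succ n ih =>
    refine fun t ht => step t fun s hs => ih s ?_
    obtain ⟨h, hp⟩ := hs
    rw [hp, SimpleGraph.Walk.length_concat]
    omega

theorem mem_path_self (t : T.node) : t ∈ (T.path t).support := SimpleGraph.Walk.end_mem_support _

theorem root_mem_path (t : T.node) : T.root ∈ (T.path t).support :=
  SimpleGraph.Walk.start_mem_support _

theorem exists_isChild_of_mem_path (h : s ∈ (T.path u).support) :
    u = s ∨ ∃ s', T.IsChild s s' ∧ s' ∈ (T.path u).support := by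
  induction u using induction_on with
  | root =>
    rw [path_root] at h
    simp only [SimpleGraph.Walk.support_nil, List.mem_singleton] at h
    exact .inl h.symm
  | child t u hu ih =>
    obtain h | rfl := hu.mem_support.1 h
    · obtain rfl | ⟨s', hs', h'⟩ := ih h
      · exact .inr ⟨u, hu, mem_path_self u⟩
      · exact .inr ⟨s', hs', hu.mem_support.2 (.inl h')⟩
    · exact .inl rfl

/-- A connected set of nodes which meets the subtree at `s` and its complement contains `s` and the
parent of `s`. -/
theorem IsChild.mem_of_connected (hs : T.IsChild t s) {S : Set T.node}
    (hS : (T.graph.induce S).Connected) (ha : a ∈ S) (hsa : s ∈ (T.path a).support) (hb : b ∈ S)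
    (hsb : s ∉ (T.path b).support) : s ∈ S ∧ t ∈ S := by
  obtain ⟨p⟩ := hS.preconnected ⟨a, ha⟩ ⟨b, hb⟩
  suffices H : ∀ a b : S, (T.graph.induce S).Walk a b → s ∈ (T.path a.1).support →
      s ∉ (T.path b.1).support → s ∈ S ∧ t ∈ S from H _ _ p hsa hsb
  intro a b p
  induction p with
  | nil => exact fun h h' => absurd h h'
  | @cons a c b hac p ih =>
    intro hsa
    by_cases hsc : s ∈ (T.path c.1).support
    · exact ih hsc
    intro _
    obtain hc | hc := isChild_or_isChild (T := T) (t := a.1) (s := c.1) hac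
    · exact absurd (hc.mem_support.2 (.inl hsa)) hsc
    · obtain h | h := hc.mem_support.1 hsa
      · exact absurd h hsc
      · subst h
        rw [hs.unique hc]
        exact ⟨a.2, c.2⟩

end RTree

variable {V : Type*}

theorem RTree.card_le_of_width {T : RTree} {β : T.node → Finset V} {k : ℕ}
    (h : T.width β ≤ (k : ℤ) - 1) (t : T.node) : (β t).card ≤ k := by
  have h1 : (β t).card ≤ univ.sup fun t => (β t).card :=
    Finset.le_sup (f := fun t => (β t).card) (Finset.mem_univ t)
  unfold RTree.width at h
  omega

theorem RTree.width_le {T : RTree} {β : T.node → Finset V} {k : ℕ}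
    (h : ∀ t, (β t).card ≤ k) : T.width β ≤ (k : ℤ) - 1 := by
  have : (univ.sup fun t => (β t).card) ≤ k := Finset.sup_le fun t _ => h t
  unfold RTree.width
  omega

/-! ### From tree decompositions to monotone strategies -/

section TreeDec

variable {G : LoopGraph V} {T : RTree} {β : T.node → Finset V} {k q : ℕ} {s t : T.node}

theorem IsTreeDec.bag_of_below (h : IsTreeDec G T β) (hs : T.IsChild t s) {v : V} {a : T.node}
    (ha : v ∈ β a) (hsa : s ∈ (T.path a).support) {b : T.node} (hb : v ∈ β b)
    (hsb : s ∉ (T.path b).support) : v ∈ β s ∧ v ∈ β t :=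
  hs.mem_of_connected (h.connected v) ha hsa hb hsb

/-- The edges which have an end outside the bag of `t` that lies in a bag below `s`. -/
def edgesBelow (G : LoopGraph V) (T : RTree) (β : T.node → Finset V) (t s : T.node) :
    Set (Sym2 V) :=
  {e ∈ G.edges | ∃ w ∈ e, w ∉ β t ∧ ∃ u, w ∈ β u ∧ s ∈ (T.path u).support}

/-- The end `w` has a bag below `s` but is not in `β t`, so by connectedness all its bags lie below
`s`, among them one that contains `e`. -/
theorem IsTreeDec.exists_below (h : IsTreeDec G T β) (hs : T.IsChild t s) {e : Sym2 V}
    (he : e ∈ edgesBelow G T β t s) : ∃ u, s ∈ (T.path u).support ∧ ∀ v ∈ e, v ∈ β u := by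
  obtain ⟨he, w, hw, hwt, u, hwu, hu⟩ := he
  obtain ⟨u', hu'⟩ := h.edge_mem e he
  refine ⟨u', ?_, hu'⟩
  by_contra hn
  exact hwt (h.bag_of_below hs hwu hu (hu' w hw) hn).2

variable [DecidableEq V]

/-- The union of the bags on the path from the root. -/
noncomputable def pathBags (T : RTree) (β : T.node → Finset V) (t : T.node) : Finset V :=
  (T.path t).support.toFinset.biUnion β

theorem mem_pathBags {v : V} : v ∈ pathBags T β t ↔ ∃ u ∈ (T.path t).support, v ∈ β u := by
  simp [pathBags]

theorem pathBags_root : pathBags T β T.root = β T.root := by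
  simp [pathBags, RTree.path_root]

/-- A vertex of `β s \ β t` occurs nowhere on the path to `t`, since connectedness would put it into
`β t`. Hence the placements along a root path are bounded by the depth. -/
theorem IsTreeDec.card_pathBags (h : IsTreeDec G T β) (hs : T.IsChild t s) :
    (β s \ β t).card + (pathBags T β t).card ≤ (pathBags T β s).card := by
  rw [← Finset.card_union_of_disjoint]
  · refine Finset.card_le_card fun v hv => ?_
    rw [mem_pathBags]
    obtain hv | hv := Finset.mem_union.1 hv
    · exact ⟨s, RTree.mem_path_self s, (Finset.mem_sdiff.1 hv).1⟩
    · obtain ⟨u, hu, hv⟩ := mem_pathBags.1 hv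
      exact ⟨u, hs.mem_support.2 (.inl hu), hv⟩
  · rw [Finset.disjoint_left]
    intro v hv hv'
    obtain ⟨u, hu, hvu⟩ := mem_pathBags.1 hv'
    rw [Finset.mem_sdiff] at hv
    refine hv.2 (h.bag_of_below hs hv.1 (RTree.mem_path_self s) hvu fun hsu => ?_).2
    refine hs.notMem ?_
    have h1 : ((T.path t).takeUntil u hu) = T.path u :=
      RTree.eq_path ((T.path_isPath t).takeUntil hu)
    rw [← h1] at hsu
    exact SimpleGraph.Walk.support_takeUntil_subset_support _ hu hsu

theorem IsTreeDec.forces (h : IsTreeDec G T β) (hk : ∀ t, (β t).card ≤ k)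
    (hq : ∀ t, (pathBags T β t).card ≤ q) (hs : T.IsChild t s) {e : Sym2 V}
    (he : e ∈ edgesBelow G T β t s) :
    Forces G True k (q - (pathBags T β t).card) (β t) e := by
  revert t e
  induction s using RTree.leaves_induction with
  | step s ih =>
  intro t hs e he
  have mem_s : ∀ f ∈ edgesBelow G T β t s, ∀ v ∈ f, v ∈ β t → v ∈ β s := by
    intro f hf v hv hvt
    obtain ⟨u, hu, hfu⟩ := h.exists_below hs hf
    exact (h.bag_of_below hs (hfu v hv) hu hvt hs.notMem).1
  have hbt : G.boundary (edgesBelow G T β t s) ⊆ (β t : Set V) := by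
    rintro v ⟨f, hf, f', ⟨hf', hn⟩, hvf, hvf'⟩
    by_contra hvt
    obtain ⟨u, hu, hfu⟩ := h.exists_below hs hf
    exact hn ⟨hf', v, hvf', hvt, u, hfu v hvf, hu⟩
  have hbs : G.boundary (edgesBelow G T β t s) ⊆ (β s : Set V) := by
    intro v hv
    have hvt := hbt hv
    obtain ⟨f, hf, -, -, hvf, -⟩ := hv
    exact mem_s f hf v hvf hvt
  have hcard := h.card_pathBags hs
  have hqs := hq s
  refine Forces.mono_budget (b := q - (pathBags T β s).card + (β s \ β t).card) ?_ (by omega)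
  refine Forces.move hbt hbs (hk s) ?_ he fun _ => ?_
  · intro f hf
    by_cases hc : Captured (β s) f
    · exact .of_captured hc
    obtain ⟨w, hw, hws⟩ : ∃ w ∈ f, w ∉ β s := by
      simpa [Captured] using hc
    obtain ⟨u, hu, hfu⟩ := h.exists_below hs hf
    obtain rfl | ⟨s', hs', hu'⟩ := RTree.exists_isChild_of_mem_path hu
    · exact absurd (hfu w hw) hws
    · exact ih s' hs' hs' ⟨hf.1, w, hw, hws, u, hfu w hw, hu'⟩
  -- Monotonicity: the boundary of the current robber region lies in `β t`, and also in `β s`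
  -- because its vertices have bags below `s`. So `β t ∩ β s` already guards it.
  · have hsub : G.escape (β t) e ⊆ edgesBelow G T β t s :=
      LoopGraph.escape_subset_of_boundary hbt he
    refine LoopGraph.escape_subset_of_boundary ?_ (LoopGraph.self_mem_escape he.1)
    intro v hv
    have hvt := LoopGraph.boundary_escape_subset he.1 hv
    obtain ⟨f, hf, -, -, hvf, -⟩ := hv
    rw [Finset.coe_inter]
    exact ⟨hvt, mem_s f (hsub hf) v hvf hvt⟩

theorem HasTreeDec.copsWinMonotone (h : HasTreeDec G k q) : CopsWinMonotone G k q := by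
  obtain ⟨T, β, h, hw, hd⟩ := h
  have hk := RTree.card_le_of_width hw
  have hq : ∀ t, (pathBags T β t).card ≤ q := fun t =>
    (Finset.le_sup (f := fun t => (pathBags T β t).card) (Finset.mem_univ t)).trans hd
  refine copsWinMonotone_of_forces fun e he => ?_
  have hr := hq T.root
  rw [pathBags_root] at hr
  refine Forces.mono_budget (b := q - (β T.root).card + (β T.root \ ∅).card) ?_
    (by rw [Finset.sdiff_empty]; omega)
  have hE : G.boundary G.edges = ∅ := by
    ext v
    simp [LoopGraph.boundary]
  refine Forces.move (C := G.edges) (by simp [hE]) (by simp [hE]) (hk _) ?_ he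
    (by simp)
  intro f hf
  by_cases hc : Captured (β T.root) f
  · exact .of_captured hc
  obtain ⟨w, hw, hwr⟩ : ∃ w ∈ f, w ∉ β T.root := by
    simpa [Captured] using hc
  obtain ⟨u, hu⟩ := h.vertex_mem w
  obtain rfl | ⟨s, hs, hsu⟩ := RTree.exists_isChild_of_mem_path (RTree.root_mem_path u)
  · exact absurd hu hwr
  · have := h.forces hk hq hs ⟨hf, w, hw, hwr, u, hu, hsu⟩
    rwa [pathBags_root] at this

theorem hasTreeDec_addLoops : HasTreeDec G.addLoops k q ↔ HasTreeDec G k q := by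
  refine exists_congr fun T => exists_congr fun β => and_congr_left fun _ => ?_
  constructor
  · exact fun h => ⟨h.vertex_mem, fun e he => h.edge_mem e (.inl he), h.connected⟩
  · refine fun h => ⟨h.vertex_mem, ?_, h.connected⟩
    rintro e (he | ⟨v, rfl⟩)
    · exact h.edge_mem e he
    · simpa using h.vertex_mem v

end TreeDec

/-! ### From exact pre-tree decompositions to strategies -/

section PreTreeDec

variable {G : LoopGraph V} {T : RTree} {β : T.node → Finset V}
  {γ : T.node → T.node → Set (Sym2 V)} {k q : ℕ} {s t : T.node}

/-- In a graph with all loops, an edge either is a loop meeting no other edge, or all its ends lie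
on further edges. -/
theorem LoopGraph.isolated_or (hG : ∀ v, s(v, v) ∈ G.edges) (e : Sym2 V) :
    (∃ v, e = s(v, v) ∧ ∀ f ∈ G.edges, v ∈ f → f = e) ∨
      ∀ v ∈ e, ∃ f ∈ G.edges, f ≠ e ∧ v ∈ f := by
  by_cases hv : ∃ v, e = s(v, v)
  · obtain ⟨v, rfl⟩ := hv
    by_cases h : ∀ f ∈ G.edges, v ∈ f → f = s(v, v)
    · exact .inl ⟨v, rfl, h⟩
    · push Not at h
      obtain ⟨f, hf, hvf, hne⟩ := h
      refine .inr fun w hw => ⟨f, hf, hne, ?_⟩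
      simp only [Sym2.mem_iff, or_self] at hw
      rwa [hw]
  · exact .inr fun v _ => ⟨s(v, v), hG v, fun h => hv ⟨v, h.symm⟩, Sym2.mem_mk_left _ _⟩

theorem IsPreTreeDec.boundary_subset_bag (h : IsPreTreeDec G T β γ) (hst : T.graph.Adj t s) :
    G.boundary (γ t s) ⊆ (β t : Set V) := fun _ hv =>
  h.boundary_subset t ⟨some ⟨s, hst⟩, hv⟩

theorem IsPreTreeDec.cone_subset (h : IsPreTreeDec G T β γ) (hst : T.graph.Adj t s) :
    γ t s ⊆ G.edges := by
  rw [← (h.partition t).1]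
  exact Set.subset_iUnion (partitionAt G T γ t) (some ⟨s, hst⟩)

/-- The two cones at a tree edge are complementary, hence have the same boundary, which therefore
lies in both bags. -/
theorem IsPreTreeDec.compl_cone (h : IsPreTreeDec G T β γ) (he : IsExact G T β γ)
    (hst : T.graph.Adj t s) : G.edges \ γ s t = γ t s := by
  rw [← he.edge_exact t s hst, Set.union_sdiff_right, sdiff_eq_left]
  exact h.disjoint t s hst

theorem IsPreTreeDec.exists_cone (h : IsPreTreeDec G T β γ) (ht : ¬ T.IsLeaf t) {e : Sym2 V}
    (he : e ∈ G.edges) : ∃ s, T.graph.Adj t s ∧ e ∈ γ t s := by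
  rw [← (h.partition t).1] at he
  obtain ⟨i, hi⟩ := Set.mem_iUnion.1 he
  cases i with
  | none => simp [partitionAt, ht] at hi
  | some s => exact ⟨s, s.2, hi⟩

variable [DecidableEq V]

/-- The number of placements on the path from the root. -/
noncomputable def placements (T : RTree) (β : T.node → Finset V) (t : T.node) : ℕ :=
  ((T.path t).darts.map fun d => (β d.snd \ β d.fst).card).sum

theorem placements_child (hs : T.IsChild t s) :
    placements T β s = placements T β t + (β s \ β t).card := by
  obtain ⟨h, hp⟩ := hs
  simp [placements, hp, SimpleGraph.Walk.darts_concat]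

theorem placements_root : placements T β T.root = 0 := by
  simp [placements, RTree.path_root]

theorem IsPreTreeDec.forces (h : IsPreTreeDec G T β γ) (hex : IsExact G T β γ)
    (hG : ∀ v, s(v, v) ∈ G.edges)
    (hk : ∀ t, (β t).card ≤ k) (hq : ∀ t, placements T β t ≤ q) (hs : T.IsChild t s)
    {e : Sym2 V} (he : e ∈ γ t s) (hn : ∀ v ∈ e, ∃ f ∈ G.edges, f ≠ e ∧ v ∈ f) :
    Forces G False k (q - placements T β t) (β t) e := by
  revert t e
  induction s using RTree.leaves_induction with
  | step s ih =>
  intro t hs e he hn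
  have hadj := hs.1
  by_cases hl : T.IsLeaf s
  -- The cone at a leaf is `{e}`, and every end of `e` lies on a further edge, so it is a boundary
  -- vertex and carries a cop.
  · refine .of_captured fun v hv => h.boundary_subset_bag hadj ?_
    obtain ⟨f, hf, hfe, hvf⟩ := hn v hv
    refine ⟨e, he, f, ⟨hf, fun hf' => hfe ?_⟩, hv, hvf⟩
    exact Set.encard_le_one_iff.1 (h.leaf_cone s t hl hadj) f e hf' he
  -- Isolated loops have empty boundary and need not be covered by any bag. They are removed from
  -- the robber region, which does not enlarge its boundary.
  set C : Set (Sym2 V) := {f ∈ γ t s | ∀ v ∈ f, ∃ f' ∈ G.edges, f' ≠ f ∧ v ∈ f'}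
  have hCb : G.boundary C ⊆ G.boundary (γ t s) := by
    rintro v ⟨f, hf, f', ⟨hf', hn'⟩, hvf, hvf'⟩
    refine ⟨f, hf.1, f', ⟨hf', fun hc => hn' ⟨hc, ?_⟩⟩, hvf, hvf'⟩
    refine (LoopGraph.isolated_or hG f').resolve_left ?_
    rintro ⟨w, rfl, hw⟩
    simp only [Sym2.mem_iff, or_self] at hvf'
    subst hvf'
    exact hn' (hw f (h.cone_subset hadj hf.1) hvf ▸ hf)
  have hbs : G.boundary (γ t s) ⊆ (β s : Set V) := by
    rw [← h.compl_cone hex hadj, LoopGraph.boundary_compl (h.cone_subset hadj.symm)]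
    exact h.boundary_subset_bag hadj.symm
  have hp := placements_child (β := β) hs
  have hqs := hq s
  refine Forces.mono_budget (b := q - placements T β s + (β s \ β t).card) ?_ (by omega)
  refine Forces.move (C := C) (hCb.trans (h.boundary_subset_bag hadj)) (hCb.trans hbs) (hk s) ?_
    ⟨he, hn⟩ False.elim
  intro f hf
  obtain ⟨u, hu, hfu⟩ := h.exists_cone hl (h.cone_subset hadj hf.1)
  obtain hc | hc := RTree.isChild_or_isChild hu
  · exact ih u hc hc hfu hf.2
  · rw [hc.unique hs] at hfu
    exact absurd hfu ((h.disjoint t s hadj).notMem_of_mem_left hf.1)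

theorem HasExactPreTreeDec.copsWin (hG : ∀ v, s(v, v) ∈ G.edges) (hk : 1 ≤ k) (hq : 1 ≤ q)
    (h : HasExactPreTreeDec G k q) : CopsWin G k q := by
  obtain ⟨T, β, γ, h, hex, hw, hd⟩ := h
  have hk' := RTree.card_le_of_width hw
  have hq' : ∀ t, placements T β t ≤ q := fun t =>
    (Finset.le_sup (f := placements T β) (Finset.mem_univ t)).trans hd
  rw [copsWin_iff_forces]
  intro e he
  obtain ⟨v, rfl, hv⟩ | hn := LoopGraph.isolated_or hG e
  · exact .of_isolated hk hq he hv
  obtain ⟨c, hc, hce⟩ := h.root_cone (G.adj.connectedComponentMk e.out.1)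
  have hec : e ∈ γ T.root c := by
    rw [hce]
    refine ⟨he, fun v hv => ?_⟩
    rw [SimpleGraph.ConnectedComponent.mem_supp_iff, SimpleGraph.ConnectedComponent.eq]
    by_cases hve : v = e.out.1
    · rw [hve]
    · refine SimpleGraph.Adj.reachable ?_
      rw [LoopGraph.adj, SimpleGraph.fromEdgeSet_adj]
      exact ⟨(Sym2.mem_and_mem_iff hve).1 ⟨hv, e.out_fst_mem⟩ ▸ he, hve⟩
  have hchild : T.IsChild T.root c := RTree.isChild_of_notMem hc (by
    rw [RTree.path_root]
    simpa using hc.ne')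
  have := h.forces hex hG hk' hq' hchild hec hn
  rwa [placements_root, h.root_bag] at this

end PreTreeDec

end CopsRobber

namespace CopsRobber

variable {V : Type*}

/-! ### Labellings of the edges and their boundaries -/

namespace LoopGraph

/-- The vertices which are incident to edges with different labels. -/
def splitVertices (G : LoopGraph V) {κ : Type*} (p : Sym2 V → κ) : Set V :=
  {v | ∃ e ∈ G.edges, ∃ e' ∈ G.edges, v ∈ e ∧ v ∈ e' ∧ p e ≠ p e'}

open Classical in
/-- Submodularity: moving a set `F` of edges into one of the parts of a partition does not enlarge
the boundary of the partition, if the boundary of `F` is small enough. -/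
theorem ncard_splitVertices_le [Finite V] (G : LoopGraph V) {κ : Type*} (p : Sym2 V → κ)
    {F : Set (Sym2 V)} {a : κ} (hF : F ⊆ G.edges)
    (h : (G.boundary F).ncard ≤ (G.boundary (F ∩ {e | p e = a})).ncard) :
    (G.splitVertices fun e => if e ∈ F then a else p e).ncard ≤ (G.splitVertices p).ncard := by
  set p' : Sym2 V → κ := fun e => if e ∈ F then a else p e with hp'
  have h1 := Set.ncard_union_add_ncard_inter (G.splitVertices p') (G.boundary (F ∩ {e | p e = a}))
  have h2 := Set.ncard_union_add_ncard_inter (G.splitVertices p) (G.boundary F)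
  have pos : ∀ e ∈ F, p' e = a := fun e he => by simp [hp', he]
  have neg : ∀ e ∉ F, p' e = p e := fun e he => by simp [hp', he]
  -- Uncrossing: both the union and the intersection of the two new boundaries lie in those of the
  -- old ones; counting gives the claim.
  have hu : G.splitVertices p' ∪ G.boundary (F ∩ {e | p e = a}) ⊆
      G.splitVertices p ∪ G.boundary F := by
    rintro v (⟨e, he, e', he', hv, hv', hne⟩ | ⟨e, he, e', ⟨he', hn⟩, hv, hv'⟩)
    · by_cases heF : e ∈ F <;> by_cases heF' : e' ∈ F
      · exact absurd ((pos e heF).trans (pos e' heF').symm) hne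
      · exact .inr ⟨e, heF, e', ⟨he', heF'⟩, hv, hv'⟩
      · exact .inr ⟨e', heF', e, ⟨he, heF⟩, hv', hv⟩
      · rw [neg e heF, neg e' heF'] at hne
        exact .inl ⟨e, he, e', he', hv, hv', hne⟩
    · by_cases heF' : e' ∈ F
      · refine .inl ⟨e, hF he.1, e', he', hv, hv', fun heq => hn ⟨heF', ?_⟩⟩
        exact heq.symm.trans he.2
      · exact .inr ⟨e, he.1, e', ⟨he', heF'⟩, hv, hv'⟩
  have hi : G.splitVertices p' ∩ G.boundary (F ∩ {e | p e = a}) ⊆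
      G.splitVertices p ∩ G.boundary F := by
    rintro v ⟨⟨e, he, e', he', hv, hv', hne⟩, ⟨f, hf, -, -, hvf, -⟩⟩
    obtain ⟨g, hg, hvg, hga⟩ : ∃ g ∈ G.edges, v ∈ g ∧ p' g ≠ a := by
      by_cases h : p' e = a
      · exact ⟨e', he', hv', fun h' => hne (h.trans h'.symm)⟩
      · exact ⟨e, he, hv, h⟩
    have hgF : g ∉ F := fun hgF => hga (pos g hgF)
    rw [neg g hgF] at hga
    exact ⟨⟨f, hF hf.1, g, hg, hvf, hvg, fun heq => hga (heq.symm.trans hf.2)⟩,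
      ⟨f, hf.1, g, ⟨hg, hgF⟩, hvf, hvg⟩⟩
  have h3 := Set.ncard_le_ncard hu
  have h4 := Set.ncard_le_ncard hi
  omega

/-- The edges placed at or below the node `s`. A node of a tree is the list of the letters on the
path to the root, so that `s.tail` is the parent of `s`; the edge `e` is placed at `lam e`. -/
def cone (G : LoopGraph V) (lam : Sym2 V → List ℕ) (s : List ℕ) : Set (Sym2 V) :=
  {e ∈ G.edges | s <:+ lam e}

/-- The vertices in the boundary of the cone of one of the nodes in `S`. -/
def coneBoundary (G : LoopGraph V) (lam : Sym2 V → List ℕ) (S : Set (List ℕ)) : Set V :=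
  {v | ∃ s ∈ S, v ∈ G.boundary (G.cone lam s)}

/-- Recording all cones over `S` in one labelling makes `ncard_splitVertices_le` applicable to any
set of nodes, in particular to stars (bags) and spines (path unions). -/
theorem coneBoundary_eq_splitVertices (G : LoopGraph V) (lam : Sym2 V → List ℕ)
    (S : Set (List ℕ)) :
    G.coneBoundary lam S = G.splitVertices fun e => {s ∈ S | s <:+ lam e} := by
  ext v
  constructor
  · rintro ⟨s, hs, e, he, e', ⟨he', hn⟩, hv, hv'⟩
    refine ⟨e, he.1, e', he', hv, hv', fun h => hn ⟨he', ?_⟩⟩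
    exact ((Set.ext_iff.1 h s).1 ⟨hs, he.2⟩).2
  · rintro ⟨e, he, e', he', hv, hv', hne⟩
    obtain ⟨s, hs⟩ := Set.symmDiff_nonempty.2 hne
    obtain ⟨⟨hs, h1⟩, h2⟩ | ⟨⟨hs, h1⟩, h2⟩ := hs
    · exact ⟨s, hs, e, ⟨he, h1⟩, e', ⟨he', fun h => h2 ⟨hs, h.2⟩⟩, hv, hv'⟩
    · exact ⟨s, hs, e', ⟨he', h1⟩, e, ⟨he, fun h => h2 ⟨hs, h.2⟩⟩, hv', hv⟩

theorem coneBoundary_mono (G : LoopGraph V) (lam : Sym2 V → List ℕ) {S S' : Set (List ℕ)}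
    (h : S ⊆ S') : G.coneBoundary lam S ⊆ G.coneBoundary lam S' :=
  fun _ ⟨s, hs, hv⟩ => ⟨s, h hs, hv⟩

end LoopGraph

/-- The node `t` and its children. -/
def star (t : List ℕ) : Set (List ℕ) := {s | s = t ∨ s.tail = t}

/-- The nodes on the path to `t` and their children. -/
def spine (t : List ℕ) : Set (List ℕ) := {s | s.tail <:+ t}

theorem star_subset_spine {t u : List ℕ} (h : u <:+ t) : star u ⊆ spine t := by
  rintro s (rfl | rfl)
  · exact (List.tail_suffix s).trans h
  · exact h

theorem spine_mono {t u : List ℕ} (h : u <:+ t) : spine u ⊆ spine t :=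
  fun _ hs => List.IsSuffix.trans hs h

variable [DecidableEq V]

/-- A tree on lists together with a placement of the edges at its leaves, such that the cop player
still wins on the edges of any leaf with the remaining placements. The inner nodes are
the proper suffixes of the leaves. -/
structure IsPartialDec (G : LoopGraph V) (k q : ℕ) (code : Set (Sym2 V) → ℕ)
    (lam : Sym2 V → List ℕ) : Prop where
  eq_of_suffix : ∀ e ∈ G.edges, ∀ e' ∈ G.edges, lam e <:+ lam e' → lam e = lam e'
  last : ∀ e ∈ G.edges, ∃ u, lam e = u ++ [code (G.escape ∅ e)]
  card_star : ∀ e ∈ G.edges, ∀ c t, c :: t <:+ lam e → (G.coneBoundary lam (star t)).ncard ≤ k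
  card_spine : ∀ e ∈ G.edges, ∀ c t, c :: t <:+ lam e →
    (G.coneBoundary lam (spine t)).ncard ≤ t.length
  -- The letter next to the root only selects a component and costs no placement, hence `q + 1`.
  -- Inclusion in the robber region suffices, so a leaf may later lose edges.
  forces : ∀ e ∈ G.edges, ∃ X f b, f ∈ G.edges ∧ b + (lam e).length = q + 1 ∧
    G.cone lam (lam e) ⊆ G.escape X f ∧ Forces G False k b X f

/-! ### Splitting a leaf by one cop move -/

section Step

variable {G : LoopGraph V} {k q : ℕ} {code : Set (Sym2 V) → ℕ} {lam : Sym2 V → List ℕ}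

theorem IsPartialDec.eq_of_mem_cone (h : IsPartialDec G k q code lam) {e e' : Sym2 V}
    (he : e ∈ G.edges) (he' : e' ∈ G.cone lam (lam e)) : lam e' = lam e :=
  (h.eq_of_suffix e he e' he'.1 he'.2).symm

theorem IsPartialDec.not_suffix (h : IsPartialDec G k q code lam) {e e' : Sym2 V}
    (he : e ∈ G.edges) (he' : e' ∈ G.edges) {c : ℕ} {t : List ℕ} (ht : c :: t <:+ lam e') :
    ¬ lam e <:+ t := by
  intro hs
  have h1 := h.eq_of_suffix e he e' he' (hs.trans ((List.suffix_cons c t).trans ht))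
  have h2 := ht.length_le
  have h3 := hs.length_le
  rw [h1] at h3
  simp at h2
  omega

/-- The leaf `lam e₀` becomes an inner node where a cop is placed. -/
theorem IsPartialDec.step [Finite V] (hG : ∀ v, s(v, v) ∈ G.edges)
    (hcode : Function.Injective code) (h : IsPartialDec G k q code lam) {e₀ e₁ : Sym2 V}
    (he₀ : e₀ ∈ G.edges) (he₁ : e₁ ∈ G.edges) (hne : e₀ ≠ e₁) (hlam : lam e₁ = lam e₀) :
    ∃ lam', IsPartialDec G k q code lam' ∧ ∀ e ∈ G.edges,
      (lam e ≠ lam e₀ ∧ lam' e = lam e) ∨ ∃ c, lam' e = c :: lam e₀ := by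
  classical
  obtain ⟨X, f₀, b, hf₀, hb, hX, hforce⟩ := h.forces e₀ he₀
  set l := lam e₀ with hl
  have hl_ne : l ≠ [] := by
    obtain ⟨u, hu⟩ := h.last e₀ he₀
    rw [hl, hu]; simp
  have hA : ∀ e ∈ G.edges, l <:+ lam e → lam e = l := fun e he hs =>
    h.eq_of_mem_cone he₀ ⟨he, hs⟩
  -- The robber region of a captured edge is a single edge, but the leaf carries both `e₀` and `e₁`.
  have hcap : ¬ Captured X f₀ := by
    intro hc
    have h0 := LoopGraph.eq_of_mem_escape_of_captured_left (hX ⟨he₀, List.suffix_rfl⟩) hc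
    have h1 := LoopGraph.eq_of_mem_escape_of_captured_left
      (hX ⟨he₁, hlam ▸ List.suffix_rfl⟩) hc
    exact hne (h0.trans h1.symm)
  obtain _ | b := b
  · exact absurd hforce hcap
  obtain hforce | ⟨X', hX', v, hk, -, hforce⟩ := hforce
  · exact absurd hforce hcap
  set R := G.escape X' f₀ with hR
  have hAR : G.cone lam l ⊆ R := hX.trans (LoopGraph.escape_anti hX')
  -- For a non-monotone move `R` exceeds the edge set of the leaf. The set `F` of least boundary in
  -- between is the one pulled into the leaf.
  obtain ⟨F, ⟨hAF, hFR⟩, hmin⟩ := Set.exists_min_image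
    {F : Set (Sym2 V) | G.cone lam l ⊆ F ∧ F ⊆ R} (fun F => (G.boundary F).ncard)
    (Set.toFinite _) ⟨R, hAR, subset_rfl⟩
  have hRE : R ⊆ G.edges := LoopGraph.escape_subset
  have hFE : F ⊆ G.edges := hFR.trans hRE
  have hlF : ∀ e ∈ G.edges, l <:+ lam e → e ∈ F := fun e he hs => hAF ⟨he, hs⟩
  set cd : Sym2 V → ℕ := fun e => code (G.escape (insert v X') e) with hcd
  have hcd_eq : ∀ x ∉ insert v X', ∀ e ∈ G.edges, ∀ e' ∈ G.edges, x ∈ e → x ∈ e' →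
      cd e = cd e' := by
    intro x hx e he e' he' hxe hxe'
    rw [hcd]
    exact congrArg code (LoopGraph.escape_eq_escape he'
      (LoopGraph.mem_escape_of_mem he' he hxe' hxe hx))
  set lam₁ : Sym2 V → List ℕ := fun e => if e ∈ F then l else lam e with hlam₁
  set lam₂ : Sym2 V → List ℕ := fun e => if e ∈ F then cd e :: l else lam e with hlam₂
  have pos : ∀ e ∈ F, lam₂ e = cd e :: l := fun e he => by simp [hlam₂, he]
  have neg : ∀ e ∉ F, lam₂ e = lam e := fun e he => by simp [hlam₂, he]
  have hlF₂ : ∀ e ∈ G.edges, l <:+ lam₂ e → e ∈ F := by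
    intro e he hs
    by_contra hn
    rw [neg e hn] at hs
    exact hn (hlF e he hs)
  -- The edges of `F` with the same label as `l` contain the cone of `l` and lie in `R`, so they
  -- compete with `F` in the minimisation. This is the hypothesis of submodularity.
  have card₁ : ∀ S, (G.coneBoundary lam₁ S).ncard ≤ (G.coneBoundary lam S).ncard := by
    intro S
    rw [LoopGraph.coneBoundary_eq_splitVertices, LoopGraph.coneBoundary_eq_splitVertices]
    have : (fun e => {s ∈ S | s <:+ lam₁ e}) =
        fun e => if e ∈ F then {s ∈ S | s <:+ l} else {s ∈ S | s <:+ lam e} := by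
      funext e
      by_cases he : e ∈ F <;> simp [hlam₁, he]
    rw [this]
    refine G.ncard_splitVertices_le _ hFE (hmin _ ⟨fun e he => ⟨hAF he, ?_⟩, ?_⟩)
    · simp only [Set.mem_ofPred_eq, hA e he.1 he.2]
    · exact Set.inter_subset_left.trans hFR
  -- The placements `lam₁` and `lam₂` can be told apart only by children of `l`.
  have card₂ : ∀ S, (∀ s ∈ S, s.tail ≠ l) →
      (G.coneBoundary lam₂ S).ncard ≤ (G.coneBoundary lam S).ncard := by
    intro S hS
    refine le_trans (le_of_eq ?_) (card₁ S)
    rw [LoopGraph.coneBoundary_eq_splitVertices, LoopGraph.coneBoundary_eq_splitVertices]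
    congr 2
    funext e
    ext s
    simp only [Set.mem_ofPred_eq, and_congr_right_iff]
    intro hs
    by_cases he : e ∈ F
    · simp only [hlam₁, hlam₂, he, if_true, List.suffix_cons_iff]
      refine or_iff_right ?_
      rintro rfl
      exact hS _ hs rfl
    · simp [hlam₁, hlam₂, he]
  have inner : ∀ e ∈ G.edges, ∀ c t, c :: t <:+ lam₂ e → t ≠ l →
      ∃ e' ∈ G.edges, ∃ c', c' :: t <:+ lam e' := by
    intro e he c t hs ht
    by_cases heF : e ∈ F
    · rw [pos e heF, List.suffix_cons_iff] at hs
      obtain hs | hs := hs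
      · exact absurd (List.cons.inj hs).2 ht
      · exact ⟨e₀, he₀, c, hs⟩
    · rw [neg e heF] at hs
      exact ⟨e, he, c, hs⟩
  have tail_star : ∀ e ∈ G.edges, ∀ c t, c :: t <:+ lam e → ∀ s ∈ star t, s.tail ≠ l := by
    intro e he c t hs s hst heq
    refine h.not_suffix he₀ he hs ?_
    rw [← hl, ← heq]
    exact star_subset_spine List.suffix_rfl hst
  have tail_spine : ∀ e ∈ G.edges, ∀ c t, c :: t <:+ lam e → ∀ s ∈ spine t, s.tail ≠ l := by
    intro e he c t hs s hst heq
    refine h.not_suffix he₀ he hs ?_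
    rw [← hl, ← heq]
    exact hst
  refine ⟨lam₂, ⟨?_, ?_, ?_, ?_, ?_⟩, ?_⟩
  · intro e he e' he' hs
    by_cases heF : e ∈ F
    · have heF' : e' ∈ F := by
        refine hlF₂ e' he' (List.IsSuffix.trans ?_ hs)
        rw [pos e heF]
        exact List.suffix_cons _ _
      refine hs.eq_of_length ?_
      rw [pos e heF, pos e' heF']
      rfl
    · rw [neg e heF] at hs ⊢
      by_cases heF' : e' ∈ F
      · rw [pos e' heF', List.suffix_cons_iff] at hs
        obtain hs | hs := hs
        · exact absurd (hlF e he (hs ▸ List.suffix_cons _ _)) heF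
        · exact absurd (hlF e he (h.eq_of_suffix e he e₀ he₀ hs ▸ List.suffix_rfl)) heF
      · rw [neg e' heF'] at hs ⊢
        exact h.eq_of_suffix e he e' he' hs
  · intro e he
    by_cases heF : e ∈ F
    · obtain ⟨u, hu⟩ := h.last e₀ he₀
      refine ⟨cd e :: u, ?_⟩
      have h0 := LoopGraph.escape_anti (Finset.empty_subset X') (hAR ⟨he₀, List.suffix_rfl⟩)
      have h1 := LoopGraph.escape_anti (Finset.empty_subset X') (hFR heF)
      rw [pos e heF, hl, hu, LoopGraph.escape_eq_escape hf₀ h0, LoopGraph.escape_eq_escape hf₀ h1]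
      rfl
    · rw [neg e heF]
      exact h.last e he
  · intro e he c t hs
    by_cases ht : t = l
    · subst ht
      -- The reference partition has the components of the new position inside `R` as parts, and
      -- everything outside `R` as one more part. Its boundary is covered by the cops.
      have hsplit : (G.splitVertices fun e => if e ∈ R then some (cd e) else none) ⊆
          (insert v X' : Finset V) := by
        rintro x ⟨e, he, e', he', hx, hx', hne⟩
        by_contra hn
        have hxX' : x ∉ X' := fun hx => hn (Finset.mem_insert_of_mem hx)
        have hiff : e ∈ R ↔ e' ∈ R := by
          constructor
          · exact fun heR => LoopGraph.escape_subset_escape hf₀ heR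
              (LoopGraph.mem_escape_of_mem he he' hx hx' hxX')
          · exact fun heR => LoopGraph.escape_subset_escape hf₀ heR
              (LoopGraph.mem_escape_of_mem he' he hx' hx hxX')
        simp only [hiff, hcd_eq x hn e he e' he' hx hx', ne_eq, not_true_eq_false] at hne
      have hcard := Set.ncard_le_ncard hsplit (Finset.finite_toSet _)
      rw [Set.ncard_coe_finset] at hcard
      refine le_trans ?_ (hcard.trans hk)
      -- Second use of submodularity: the complement of `F` is merged into the outer part. On
      -- complements the hypothesis says that the boundary of `F` is no larger than that of `R`.
      refine le_trans ?_ (G.ncard_splitVertices_le (F := G.edges \ F) (a := none) _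
        Set.sdiff_subset ?_)
      · refine Set.ncard_le_ncard ?_
        rintro x ⟨s, hs, e, ⟨he, hse⟩, e', ⟨he', hn⟩, hx, hx'⟩
        refine ⟨e, he, e', he', hx, hx', fun heq => hn ⟨he', ?_⟩⟩
        by_cases heF : e ∈ F <;> by_cases heF' : e' ∈ F
        · have hcc : cd e = cd e' := by
            simpa [heF, heF', hFR heF, hFR heF'] using heq
          rw [pos e heF, hcc] at hse
          rwa [pos e' heF']
        · simp [heF, heF', he', hFR heF] at heq
        · simp [heF, heF', he, hFR heF'] at heq
        · obtain rfl | hs := hs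
          · exact absurd (hlF₂ e he hse) heF
          · exact absurd (hlF₂ e he ((hs ▸ List.tail_suffix s).trans hse)) heF
      · have : (G.edges \ F) ∩ {e | (if e ∈ R then some (cd e) else none) = none} =
            G.edges \ R := by
          ext e
          simp only [Set.mem_inter_iff, Set.mem_sdiff, Set.mem_ofPred_eq, ite_eq_right_iff,
            reduceCtorEq, imp_false]
          exact ⟨fun h => ⟨h.1.1, h.2⟩, fun h => ⟨⟨h.1, fun h' => h.2 (hFR h')⟩, h.2⟩⟩
        rw [this, LoopGraph.boundary_compl hFE, LoopGraph.boundary_compl hRE]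
        exact hmin R ⟨hAR, subset_rfl⟩
    · obtain ⟨e', he', c', hs'⟩ := inner e he c t hs ht
      exact (card₂ _ (tail_star e' he' c' t hs')).trans (h.card_star e' he' c' t hs')
  · intro e he c t hs
    by_cases ht : t = l
    · subst ht
      obtain ⟨c₀, t₀, hct⟩ := List.exists_cons_of_ne_nil hl_ne
      -- The only possible new vertex is `v`. A vertex on edges inside and outside `F` is already in
      -- the boundary of the cone of `l`, and `l` belongs to the spine of its parent `t₀`.
      have hsub : G.coneBoundary lam₂ (spine l) ⊆ insert v (G.coneBoundary lam₂ (spine t₀)) := by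
        have exits : ∀ x, ∀ e ∈ F, ∀ e' ∈ G.edges, e' ∉ F → x ∈ e → x ∈ e' →
            x ∈ G.coneBoundary lam₂ (spine t₀) := by
          intro x e he e' he' hn hx hx'
          refine ⟨l, by rw [hct]; exact List.suffix_rfl, e, ⟨hFE he, ?_⟩, e',
            ⟨he', fun h => hn (hlF₂ e' he' h.2)⟩, hx, hx'⟩
          rw [pos e he]
          exact List.suffix_cons _ _
        rintro x ⟨s, hs, hxs⟩
        have hs' : s.tail <:+ c₀ :: t₀ := hct ▸ hs
        rw [List.suffix_cons_iff, ← hct] at hs'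
        obtain hs' | hs' := hs'
        · obtain ⟨e, ⟨he, hse⟩, e', ⟨he', hn⟩, hx, hx'⟩ := hxs
          have heF := hlF₂ e he ((hs' ▸ List.tail_suffix s).trans hse)
          by_cases heF' : e' ∈ F
          -- Here loops are needed. If the loop at `x` is in `F`, hence in `R`, then `x` is not in
          -- `X'`, as otherwise the loop would equal the uncaptured edge `f₀`. If also `x ≠ v`, the
          -- edges of `F` at `x` go to the same child.
          · by_cases hloop : s(x, x) ∈ F
            · refine .inl ?_
              by_contra hxv
              have hxX : x ∉ insert v X' := by
                rw [Finset.mem_insert, not_or]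
                refine ⟨hxv, fun hxX => hcap ?_⟩
                have hc : Captured X' s(x, x) := fun y hy => by
                  simp only [Sym2.mem_iff, or_self] at hy
                  rwa [hy]
                rw [← LoopGraph.eq_of_mem_escape_of_captured (hFR hloop) hc]
                exact hc.mono hX'
              refine hn ⟨he', ?_⟩
              rwa [pos e' heF', ← hcd_eq x hxX e he e' he' hx hx', ← pos e heF]
            · exact .inr (exits x e heF _ (hG x) hloop hx (Sym2.mem_mk_left _ _))
          · exact .inr (exits x e heF e' he' heF' hx hx')
        · exact .inr ⟨s, hs', hxs⟩
      have hs₀ : c₀ :: t₀ <:+ lam e₀ := by rw [← hl, hct]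
      have h1 := (card₂ _ (tail_spine e₀ he₀ c₀ t₀ hs₀)).trans (h.card_spine e₀ he₀ c₀ t₀ hs₀)
      have h2 := (Set.ncard_le_ncard hsub).trans (Set.ncard_insert_le _ _)
      have h3 := congrArg List.length hct
      rw [List.length_cons] at h3
      omega
    · obtain ⟨e', he', c', hs'⟩ := inner e he c t hs ht
      exact (card₂ _ (tail_spine e' he' c' t hs')).trans (h.card_spine e' he' c' t hs')
  · intro e he
    by_cases heF : e ∈ F
    · refine ⟨insert v X', e, b, he, ?_, ?_, hforce e (hFR heF)⟩
      · rw [pos e heF, List.length_cons]; omega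
      · rintro e' ⟨he', hs⟩
        rw [pos e heF] at hs
        have heF' := hlF₂ e' he' ((List.suffix_cons _ _).trans hs)
        rw [pos e' heF'] at hs
        have hcc := (List.cons.inj (hs.eq_of_length rfl)).1
        rw [hcode hcc]
        exact LoopGraph.self_mem_escape he'
    · obtain ⟨Y, f, b', hf, hb', hY, hforce'⟩ := h.forces e he
      -- The other leaves only lose edges, so their positions remain valid.
      refine ⟨Y, f, b', hf, by rwa [neg e heF], fun e' he' => hY ?_, hforce'⟩
      obtain ⟨he', hs⟩ := he'
      rw [neg e heF] at hs
      by_cases heF' : e' ∈ F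
      · rw [pos e' heF', List.suffix_cons_iff] at hs
        obtain hs | hs := hs
        · exact absurd (hlF e he (hs ▸ List.suffix_cons _ _)) heF
        · exact absurd (hlF e he (h.eq_of_suffix e he e₀ he₀ hs ▸ List.suffix_rfl)) heF
      · exact ⟨he', by rwa [neg e' heF'] at hs⟩
  · intro e he
    by_cases heF : e ∈ F
    · exact .inr ⟨_, pos e heF⟩
    · exact .inl ⟨fun heq => heF (hlF e he (heq ▸ List.suffix_rfl)), neg e heF⟩

end Step

end CopsRobber

/-! ### Iterating the splitting step -/

namespace CopsRobber

variable {V : Type*}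

/-- The leaves which carry at least two edges. -/
def openLeaves (G : LoopGraph V) (lam : Sym2 V → List ℕ) : Set (List ℕ) :=
  {l | ∃ e ∈ G.edges, ∃ e' ∈ G.edges, e ≠ e' ∧ lam e = l ∧ lam e' = l}

theorem openLeaves_finite [Finite V] (G : LoopGraph V) (lam : Sym2 V → List ℕ) :
    (openLeaves G lam).Finite :=
  (Set.toFinite (lam '' G.edges)).subset fun _ ⟨e, he, _, _, _, h, _⟩ => ⟨e, he, h⟩

variable [DecidableEq V]

section Iterate

variable {G : LoopGraph V} {k q : ℕ} {code : Set (Sym2 V) → ℕ}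

theorem IsPartialDec.initial (hcode : Function.Injective code) (h : CopsWin G k q) :
    IsPartialDec G k q code fun e => [code (G.escape ∅ e)] := by
  have hempty : ∀ S, G.coneBoundary (fun e => [code (G.escape ∅ e)]) S = ∅ := by
    intro S
    rw [Set.eq_empty_iff_forall_notMem]
    rintro v ⟨s, -, e, he, e', ⟨he', hn⟩, hv, hv'⟩
    refine hn ⟨he', ?_⟩
    beta_reduce
    rw [LoopGraph.escape_eq_escape he.1 (LoopGraph.mem_escape_of_mem he.1 he' hv hv'
      (Finset.notMem_empty v))]
    exact he.2
  refine ⟨?_, ?_, ?_, ?_, ?_⟩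
  · exact fun e _ e' _ hs => hs.eq_of_length rfl
  · exact fun e _ => ⟨[], rfl⟩
  · intro e _ c t _
    simp [hempty]
  · intro e _ c t _
    simp [hempty]
  · refine fun e he => ⟨∅, e, q, he, rfl, ?_, copsWin_iff_forces.1 h e he⟩
    rintro e' ⟨he', hs⟩
    have := (List.cons.inj (hs.eq_of_length rfl)).1
    rw [hcode this]
    exact LoopGraph.self_mem_escape he'

/-- Splitting an open leaf of length `n` puts edges only on leaves of length `n + 1` and opens no
other leaf, so the number of open leaves of length `n` drops. -/
theorem IsPartialDec.exists_of_length [Finite V] (hG : ∀ v, s(v, v) ∈ G.edges)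
    (hcode : Function.Injective code) (h : CopsWin G k q) (n : ℕ) :
    ∃ lam, IsPartialDec G k q code lam ∧ ∀ l ∈ openLeaves G lam, n ≤ l.length := by
  induction n with
  | zero => exact ⟨_, .initial hcode h, fun _ _ => Nat.zero_le _⟩
  | succ n ih =>
    suffices H : ∀ m lam, IsPartialDec G k q code lam → (∀ l ∈ openLeaves G lam, n ≤ l.length) →
        {l ∈ openLeaves G lam | l.length = n}.ncard = m →
        ∃ lam, IsPartialDec G k q code lam ∧ ∀ l ∈ openLeaves G lam, n + 1 ≤ l.length by
      obtain ⟨lam, h1, h2⟩ := ih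
      exact H _ lam h1 h2 rfl
    intro m
    induction m using Nat.strong_induction_on with
    | _ m ihm =>
    intro lam hlam hn hm
    by_cases hex : ∃ l ∈ openLeaves G lam, l.length = n
    · obtain ⟨l, hl, hln⟩ := hex
      obtain ⟨e₀, he₀, e₁, he₁, hne, rfl, h₁⟩ := id hl
      obtain ⟨lam', hlam', hstep⟩ := hlam.step hG hcode he₀ he₁ hne h₁
      have key : ∀ l' ∈ openLeaves G lam', n + 1 ≤ l'.length ∨
          l' ∈ openLeaves G lam ∧ l' ≠ lam e₀ := by
        rintro l' ⟨e, he, e', he', hee, rfl, heq⟩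
        obtain ⟨h1, h2⟩ | ⟨c, h1⟩ := hstep e he
        · obtain ⟨-, h4⟩ | ⟨c, h3⟩ := hstep e' he'
          · rw [h2] at heq ⊢
            exact .inr ⟨⟨e, he, e', he', hee, rfl, h4.symm.trans heq⟩, h1⟩
          · rw [← heq, h3, List.length_cons, hln]
            exact .inl le_rfl
        · rw [h1, List.length_cons, hln]
          exact .inl le_rfl
      refine ihm _ ?_ lam' hlam' ?_ rfl
      · rw [← hm]
        refine Set.ncard_lt_ncard ?_ ((openLeaves_finite G lam).subset (Set.sep_subset _ _))
        refine ⟨?_, fun hsub => ?_⟩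
        · rintro l' ⟨hl', hl'n⟩
          obtain h | h := key l' hl'
          · omega
          · exact ⟨h.1, hl'n⟩
        · obtain ⟨h1, -⟩ := hsub ⟨hl, hln⟩
          obtain h | h := key _ h1
          · omega
          · exact h.2 rfl
      · intro l' hl'
        obtain h | h := key l' hl'
        · omega
        · exact hn l' h.1
    · refine ⟨lam, hlam, fun l hl => ?_⟩
      have := hn l hl
      have h' : l.length ≠ n := fun h' => hex ⟨l, hl, h'⟩
      omega

/-- A tree on lists together with a placement of the edges at its leaves, at most one edge at each
leaf. -/
structure IsLeafDec (G : LoopGraph V) (k q : ℕ) (code : Set (Sym2 V) → ℕ)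
    (lam : Sym2 V → List ℕ) : Prop where
  eq_of_suffix : ∀ e ∈ G.edges, ∀ e' ∈ G.edges, lam e <:+ lam e' → e = e'
  last : ∀ e ∈ G.edges, ∃ u, lam e = u ++ [code (G.escape ∅ e)]
  card_star : ∀ e ∈ G.edges, ∀ c t, c :: t <:+ lam e → (G.coneBoundary lam (star t)).ncard ≤ k
  card_spine : ∀ e ∈ G.edges, ∀ c t, c :: t <:+ lam e → (G.coneBoundary lam (spine t)).ncard ≤ q

theorem CopsWin.exists_isLeafDec [Finite V] (hG : ∀ v, s(v, v) ∈ G.edges)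
    (hcode : Function.Injective code) (h : CopsWin G k q) :
    ∃ lam, IsLeafDec G k q code lam := by
  -- A leaf of length `q + 1` has no placements left, so its position is captured and its region is
  -- a single edge.
  obtain ⟨lam, hlam, hn⟩ := IsPartialDec.exists_of_length hG hcode h (q + 1)
  refine ⟨lam, ?_, hlam.last, hlam.card_star, ?_⟩
  · intro e he e' he' hs
    by_contra hne
    have heq := hlam.eq_of_suffix e he e' he' hs
    have hlen := hn _ ⟨e, he, e', he', hne, rfl, heq.symm⟩
    obtain ⟨X, f, b, -, hb, hX, hf⟩ := hlam.forces e he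
    obtain rfl : b = 0 := by omega
    have h0 := LoopGraph.eq_of_mem_escape_of_captured_left (hX ⟨he, List.suffix_rfl⟩) hf
    have h1 := LoopGraph.eq_of_mem_escape_of_captured_left (hX ⟨he', hs⟩) hf
    exact hne (h0.trans h1.symm)
  · intro e he c t hs
    refine (hlam.card_spine e he c t hs).trans ?_
    obtain ⟨X, f, b, -, hb, -, -⟩ := hlam.forces e he
    have := hs.length_le
    rw [List.length_cons] at this
    omega

end Iterate

end CopsRobber

namespace CopsRobber

/-! ### Trees of lists -/

/-- The graph on a set of lists in which every list is adjacent to its tail. -/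
def listGraph (S : Set (List ℕ)) : SimpleGraph S where
  Adj a b := (b.1.tail = a.1 ∧ b.1 ≠ []) ∨ (a.1.tail = b.1 ∧ a.1 ≠ [])
  symm := ⟨fun _ _ h => h.symm⟩
  loopless := ⟨fun a h => by
    have : a.1.tail = a.1 ∧ a.1 ≠ [] := h.elim id id
    obtain ⟨c, t, hct⟩ := List.exists_cons_of_ne_nil this.2
    have := congrArg List.length this.1
    simp [hct] at this⟩

theorem listGraph_isTree {S : Set (List ℕ)} (hfin : S.Finite) (h0 : [] ∈ S)
    (htail : ∀ s ∈ S, s.tail ∈ S) : (listGraph S).IsTree := by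
  have : Finite S := hfin
  rw [SimpleGraph.isTree_iff_connected_and_card]
  constructor
  · have hroot : ∀ t, ∀ ht : t ∈ S, (listGraph S).Reachable ⟨t, ht⟩ ⟨[], h0⟩ := by
      intro t
      induction t with
      | nil => exact fun _ => SimpleGraph.Reachable.refl _
      | cons c t ih =>
        intro ht
        refine SimpleGraph.Reachable.trans (SimpleGraph.Adj.reachable ?_) (ih (htail _ ht))
        exact .inr ⟨rfl, List.cons_ne_nil _ _⟩
    have : Nonempty S := ⟨⟨[], h0⟩⟩
    exact ⟨fun a b => (hroot a.1 a.2).trans (hroot b.1 b.2).symm⟩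
  -- Edges correspond to non-root nodes through the edge from a list to its tail.
  · let f : {a : S // a ≠ ⟨[], h0⟩} → (listGraph S).edgeSet := fun a =>
      ⟨s(a.1, ⟨a.1.1.tail, htail _ a.1.2⟩), .inr ⟨rfl, fun h => a.2 (Subtype.ext h)⟩⟩
    have hf : Function.Bijective f := by
      constructor
      · rintro ⟨⟨a, ha⟩, ha0⟩ ⟨⟨b, hb⟩, hb0⟩ hab
        have hab := congrArg Subtype.val hab
        simp only [f, Sym2.eq_iff, Subtype.mk.injEq] at hab
        obtain ⟨rfl, -⟩ | ⟨h1, h2⟩ := hab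
        · rfl
        · have ha : a ≠ [] := fun h => ha0 (Subtype.ext h)
          obtain ⟨c, t, rfl⟩ := List.exists_cons_of_ne_nil ha
          have h3 := congrArg List.length h1
          have h4 := congrArg List.length h2
          simp at h3 h4
          omega
      · rintro ⟨e, he⟩
        induction e with
        | _ a b =>
        obtain ⟨h1, h2⟩ | ⟨h1, h2⟩ := he
        · refine ⟨⟨b, fun h => h2 (congrArg Subtype.val h)⟩, Subtype.ext ?_⟩
          have hb : (⟨b.1.tail, htail _ b.2⟩ : S) = a := Subtype.ext h1
          change s(b, (⟨b.1.tail, htail _ b.2⟩ : S)) = s(a, b)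
          rw [hb, Sym2.eq_swap]
        · refine ⟨⟨a, fun h => h2 (congrArg Subtype.val h)⟩, Subtype.ext ?_⟩
          have hb : (⟨a.1.tail, htail _ a.2⟩ : S) = b := Subtype.ext h1
          change s(a, (⟨a.1.tail, htail _ a.2⟩ : S)) = s(a, b)
          rw [hb]
    rw [← Nat.card_eq_of_bijective f hf, ← Finite.card_option]
    classical
    exact Nat.card_congr (Equiv.optionSubtypeNe _)

/-- A tail-closed finite set of lists as a rooted tree. -/
noncomputable def listTree (S : Set (List ℕ)) (hfin : S.Finite) (h0 : [] ∈ S)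
    (htail : ∀ s ∈ S, s.tail ∈ S) : RTree where
  node := S
  fintypeNode := hfin.fintype
  graph := listGraph S
  isTree := listGraph_isTree hfin h0 htail
  root := ⟨[], h0⟩

section ListTree

variable {S : Set (List ℕ)} {hfin : S.Finite} {h0 : [] ∈ S} {htail : ∀ s ∈ S, s.tail ∈ S}

theorem listTree_isChild_and_suffix (c : ℕ) (t : List ℕ) (hct : c :: t ∈ S)
    (ht : ∀ u ∈ ((listTree S hfin h0 htail).path ⟨t, htail _ hct⟩).support, u.1 <:+ t) :
    (listTree S hfin h0 htail).IsChild ⟨t, htail _ hct⟩ ⟨c :: t, hct⟩ := by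
  refine RTree.isChild_of_notMem (.inl ⟨rfl, List.cons_ne_nil _ _⟩) fun h => ?_
  have := (ht _ h).length_le
  simp at this

theorem listTree_suffix (t : List ℕ) (ht : t ∈ S) :
    ∀ u ∈ ((listTree S hfin h0 htail).path ⟨t, ht⟩).support, u.1 <:+ t := by
  induction t with
  | nil =>
    intro u hu
    have hu' : u ∈ ((listTree S hfin h0 htail).path (listTree S hfin h0 htail).root).support := hu
    rw [RTree.path_root, SimpleGraph.Walk.support_nil, List.mem_singleton] at hu'
    subst hu'
    exact List.suffix_rfl
  | cons c t ih =>
    intro u hu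
    obtain h | rfl := (listTree_isChild_and_suffix c t ht (ih _)).mem_support.1 hu
    · exact (ih _ u h).trans (List.suffix_cons _ _)
    · exact List.suffix_rfl

theorem listTree_isChild (c : ℕ) (t : List ℕ) (hct : c :: t ∈ S) :
    (listTree S hfin h0 htail).IsChild ⟨t, htail _ hct⟩ ⟨c :: t, hct⟩ :=
  listTree_isChild_and_suffix c t hct (listTree_suffix t _)

end ListTree

theorem exists_cons_suffix {s t : List ℕ} (h : t <:+ s) (hne : t ≠ s) : ∃ c, c :: t <:+ s := by
  obtain ⟨u, rfl⟩ := h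
  obtain rfl | ⟨u, c, rfl⟩ := List.eq_nil_or_concat u
  · simp at hne
  · exact ⟨c, u, by simp⟩

theorem eq_of_suffix_of_length {s t u : List ℕ} (hs : s <:+ u) (ht : t <:+ u)
    (h : s.length = t.length) : s = t :=
  (List.suffix_of_suffix_length_le hs ht h.le).eq_of_length h

variable {V : Type*}

/-! ### Bags and path unions at all nodes of a placement -/

section LeafDec

variable {G : LoopGraph V} {k q : ℕ} {code : Set (Sym2 V) → ℕ} {lam : Sym2 V → List ℕ}

namespace IsLeafDec

theorem ne_nil (h : IsLeafDec G k q code lam) {e : Sym2 V} (he : e ∈ G.edges) : lam e ≠ [] := by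
  obtain ⟨u, hu⟩ := h.last e he
  simp [hu]

theorem singleton_suffix (h : IsLeafDec G k q code lam) {e : Sym2 V} (he : e ∈ G.edges) :
    [code (G.escape ∅ e)] <:+ lam e := by
  obtain ⟨u, hu⟩ := h.last e he
  exact ⟨u, hu.symm⟩

/-- The cones of the children of the root are unions of edges of whole components, so no vertex is
split. -/
theorem coneBoundary_nil (h : IsLeafDec G k q code lam) : G.coneBoundary lam (spine []) = ∅ := by
  rw [Set.eq_empty_iff_forall_notMem]
  rintro v ⟨s, hs, e, ⟨he, hse⟩, e', ⟨he', hn⟩, hv, hv'⟩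
  obtain _ | ⟨c, t⟩ := s
  · exact hn ⟨he', List.nil_suffix⟩
  · obtain rfl : t = [] := List.suffix_nil.1 hs
    refine hn ⟨he', ?_⟩
    rw [eq_of_suffix_of_length hse (h.singleton_suffix he) rfl,
      ← LoopGraph.escape_eq_escape he (LoopGraph.mem_escape_of_mem he he' hv hv'
      (Finset.notMem_empty v))]
    exact h.singleton_suffix he'

theorem not_suffix (h : IsLeafDec G k q code lam) {e e' : Sym2 V} (he : e ∈ G.edges)
    (he' : e' ∈ G.edges) {c : ℕ} {t : List ℕ} (ht : c :: t <:+ lam e') : ¬ lam e <:+ t := by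
  intro hs
  obtain rfl := h.eq_of_suffix e he e' he' (hs.trans ((List.suffix_cons c t).trans ht))
  have := (ht.trans hs).length_le
  simp at this

/-- No edge lies strictly below a leaf, so only the cone of the leaf itself counts, and the leaf is
in the star of its parent. -/
theorem coneBoundary_star_leaf (h : IsLeafDec G k q code lam) {e : Sym2 V} (he : e ∈ G.edges)
    {c : ℕ} {t : List ℕ} (hl : lam e = c :: t) :
    G.coneBoundary lam (star (lam e)) ⊆ G.coneBoundary lam (star t) := by
  rintro v ⟨s, rfl | hs, hv⟩
  · exact ⟨_, .inr (by rw [hl]; rfl), hv⟩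
  · obtain ⟨e', ⟨he', hse⟩, -⟩ := hv
    obtain _ | ⟨a, s⟩ := s
    · exact absurd hs.symm (h.ne_nil he)
    · exact absurd (hs ▸ List.suffix_rfl) (h.not_suffix he he' hse)

theorem coneBoundary_spine_leaf (h : IsLeafDec G k q code lam) {e : Sym2 V} (he : e ∈ G.edges)
    {c : ℕ} {t : List ℕ} (hl : lam e = c :: t) :
    G.coneBoundary lam (spine (lam e)) ⊆ G.coneBoundary lam (spine t) := by
  rintro v ⟨s, hs, hv⟩
  have hs' : s.tail <:+ c :: t := hl ▸ hs
  rw [List.suffix_cons_iff, ← hl] at hs'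
  obtain hs' | hs' := hs'
  · obtain ⟨s', hs', hv⟩ := h.coneBoundary_star_leaf he hl ⟨s, .inr hs', hv⟩
    exact ⟨s', star_subset_spine List.suffix_rfl hs', hv⟩
  · exact ⟨s, hs', hv⟩

end IsLeafDec

/-- The nodes of the tree: the suffixes of the leaves, and the root. -/
def leafNodes (G : LoopGraph V) (lam : Sym2 V → List ℕ) : Set (List ℕ) :=
  {t | t = [] ∨ ∃ e ∈ G.edges, t <:+ lam e}

theorem leafNodes_finite [Finite V] : (leafNodes G lam).Finite := by
  refine ((Set.finite_singleton []).union
    ((Set.toFinite G.edges).biUnion fun e _ => List.finite_toSet (lam e).tails)).subset ?_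
  rintro t (rfl | ⟨e, he, ht⟩)
  · exact .inl rfl
  · exact .inr (Set.mem_biUnion he ((List.mem_tails t (lam e)).2 ht))

theorem tail_mem_leafNodes : ∀ s ∈ leafNodes G lam, s.tail ∈ leafNodes G lam := by
  rintro s (rfl | ⟨e, he, hs⟩)
  · exact .inl rfl
  · exact .inr ⟨e, he, (List.tail_suffix s).trans hs⟩

theorem mem_leafNodes_of_suffix {e : Sym2 V} (he : e ∈ G.edges) {t : List ℕ} (h : t <:+ lam e) :
    t ∈ leafNodes G lam := .inr ⟨e, he, h⟩

/-- The tree underlying a placement of the edges. -/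
noncomputable def leafTree [Finite V] (G : LoopGraph V) (lam : Sym2 V → List ℕ) : RTree :=
  listTree (leafNodes G lam) leafNodes_finite (.inl rfl) tail_mem_leafNodes

theorem leafNodes_cases {t : List ℕ} (ht : t ∈ leafNodes G lam) :
    (∃ e ∈ G.edges, t = lam e) ∨ (∃ e ∈ G.edges, ∃ c, c :: t <:+ lam e) ∨ G.edges = ∅ := by
  obtain rfl | ⟨e, he, hs⟩ := ht
  · obtain hE | ⟨e, he⟩ := G.edges.eq_empty_or_nonempty
    · exact .inr (.inr hE)
    · by_cases h : [] = lam e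
      · exact .inl ⟨e, he, h⟩
      · exact .inr (.inl ⟨e, he, exists_cons_suffix List.nil_suffix h⟩)
  · by_cases h : t = lam e
    · exact .inl ⟨e, he, h⟩
    · exact .inr (.inl ⟨e, he, exists_cons_suffix hs h⟩)

theorem coneBoundary_of_edges_eq_empty (hE : G.edges = ∅) (S : Set (List ℕ)) :
    G.coneBoundary lam S = ∅ := by
  rw [Set.eq_empty_iff_forall_notMem]
  rintro v ⟨s, -, e, he, -⟩
  exact absurd he.1 (by simp [hE])

theorem IsLeafDec.card_star_node [Finite V] (h : IsLeafDec G k q code lam) {t : List ℕ}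
    (ht : t ∈ leafNodes G lam) : (G.coneBoundary lam (star t)).ncard ≤ k := by
  obtain ⟨e, he, rfl⟩ | ⟨e, he, c, hs⟩ | hE := leafNodes_cases ht
  · obtain ⟨c, t, hl⟩ := List.exists_cons_of_ne_nil (h.ne_nil he)
    exact (Set.ncard_le_ncard (h.coneBoundary_star_leaf he hl)).trans
      (h.card_star e he c t (hl ▸ List.suffix_rfl))
  · exact h.card_star e he c t hs
  · simp [coneBoundary_of_edges_eq_empty hE]

theorem IsLeafDec.card_spine_node [Finite V] (h : IsLeafDec G k q code lam) {t : List ℕ}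
    (ht : t ∈ leafNodes G lam) : (G.coneBoundary lam (spine t)).ncard ≤ q := by
  obtain ⟨e, he, rfl⟩ | ⟨e, he, c, hs⟩ | hE := leafNodes_cases ht
  · obtain ⟨c, t, hl⟩ := List.exists_cons_of_ne_nil (h.ne_nil he)
    exact (Set.ncard_le_ncard (h.coneBoundary_spine_leaf he hl)).trans
      (h.card_spine e he c t (hl ▸ List.suffix_rfl))
  · exact h.card_spine e he c t hs
  · simp [coneBoundary_of_edges_eq_empty hE]

end LeafDec

end CopsRobber

namespace CopsRobber

variable {V : Type*} {G : LoopGraph V} {k q : ℕ} {code : Set (Sym2 V) → ℕ}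
  {lam : Sym2 V → List ℕ}

/-! ### The exact pre-tree decomposition of a placement of the edges -/

open Classical in
/-- The cone at the pair `s`, `t` of adjacent nodes. -/
noncomputable def leafCone (G : LoopGraph V) (lam : Sym2 V → List ℕ) (s t : List ℕ) :
    Set (Sym2 V) :=
  if t.tail = s ∧ t ≠ [] then G.cone lam t else G.edges \ G.cone lam s

theorem leafCone_child {s t : List ℕ} {c : ℕ} (h : t = c :: s) :
    leafCone G lam s t = G.cone lam t := by
  subst h
  simp [leafCone]

theorem leafCone_parent {s t : List ℕ} {c : ℕ} (h : s = c :: t) :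
    leafCone G lam s t = G.edges \ G.cone lam s := by
  refine if_neg ?_
  rintro ⟨h', -⟩
  have := congrArg List.length h'
  simp [h] at this

theorem cone_subset_edges (s : List ℕ) : G.cone lam s ⊆ G.edges := fun _ h => h.1

theorem leafCone_subset (s t : List ℕ) : leafCone G lam s t ⊆ G.edges := by
  unfold leafCone
  split_ifs
  · exact cone_subset_edges _
  · exact Set.sdiff_subset

theorem cone_nil : G.cone lam [] = G.edges := by
  ext e
  simp [LoopGraph.cone]

theorem boundary_edges : G.boundary G.edges = ∅ := by
  ext v
  simp [LoopGraph.boundary]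

/-- Letters at the root encode robber regions without cops, while pre-tree decompositions ask for
components. The loop at `v` translates between them, also at isolated vertices. -/
theorem LoopGraph.mem_escape_empty_loop (hG : ∀ v, s(v, v) ∈ G.edges) {v : V} {f : Sym2 V} :
    f ∈ G.escape ∅ s(v, v) ↔ f ∈ G.componentEdges (G.adj.connectedComponentMk v) := by
  have hlr : ∀ u w, G.Linked ∅ u w → G.adj.Reachable u w := by
    intro u w h
    refine h.induction (G.adj.Reachable u ·) (SimpleGraph.Reachable.refl _) ?_
    intro a b _ _ hab ha
    by_cases hne : a = b
    · rwa [← hne]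
    · exact ha.trans (SimpleGraph.Adj.reachable
        (by rw [LoopGraph.adj, SimpleGraph.fromEdgeSet_adj]; exact ⟨hab, hne⟩))
  have hrl : ∀ u w, G.adj.Reachable u w → G.Linked ∅ u w := by
    rintro u w ⟨p⟩
    induction p with
    | nil => exact .refl (Finset.notMem_empty _)
    | @cons a b c hab p ih =>
      rw [LoopGraph.adj, SimpleGraph.fromEdgeSet_adj] at hab
      exact (LoopGraph.Linked.of_mem_edge hab.1 (Sym2.mem_mk_left _ _) (Sym2.mem_mk_right _ _)
        (Finset.notMem_empty _) (Finset.notMem_empty _)).trans ih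
  constructor
  · intro hf
    refine ⟨hf.1, fun w hw => ?_⟩
    rw [SimpleGraph.ConnectedComponent.mem_supp_iff, SimpleGraph.ConnectedComponent.eq]
    refine (hlr v w ?_).symm
    obtain ⟨hfE, rfl | ⟨-, u, hu, x, hx, hux⟩⟩ := LoopGraph.mem_escape.1 hf
    · simp only [Sym2.mem_iff, or_self] at hw
      rw [hw]
      exact .refl (Finset.notMem_empty _)
    · simp only [Sym2.mem_iff, or_self] at hu
      subst hu
      exact hux.trans (.of_mem_edge hfE hx hw (Finset.notMem_empty _) (Finset.notMem_empty _))
  · rintro ⟨hf, hC⟩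
    have := hC _ f.out_fst_mem
    rw [SimpleGraph.ConnectedComponent.mem_supp_iff, SimpleGraph.ConnectedComponent.eq] at this
    exact LoopGraph.mem_escape.2 ⟨hf, .inr ⟨hG v, v, Sym2.mem_mk_left _ _, _, f.out_fst_mem,
      hrl _ _ this.symm⟩⟩

/-- A vertex of the bag of a node which has occurred on the path from the root lies in the bag of
the parent. -/
theorem mem_star_of_mem_spine {c : ℕ} {t : List ℕ} {v : V}
    (hv : v ∈ G.coneBoundary lam (star (c :: t))) (hvt : v ∈ G.coneBoundary lam (spine t)) :
    v ∈ G.coneBoundary lam (star t) := by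
  by_contra hn
  have hn' : v ∉ G.boundary (G.cone lam (c :: t)) := fun hv => hn ⟨_, .inr rfl, hv⟩
  obtain ⟨s, hs, e, ⟨he, hse⟩, -, -, hve, -⟩ := hv
  have hce : c :: t <:+ lam e := by
    obtain rfl | hs := hs
    · exact hse
    · exact (hs ▸ List.tail_suffix s).trans hse
  have hall : ∀ f ∈ G.edges, v ∈ f → c :: t <:+ lam f := by
    intro f hf hvf
    by_contra hcf
    exact hn' ⟨e, ⟨he, hce⟩, f, ⟨hf, fun h => hcf h.2⟩, hve, hvf⟩
  obtain ⟨u, hu, f, ⟨hf, huf⟩, f', ⟨hf', hnf⟩, hvf, hvf'⟩ := hvt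
  -- Since `u` is no longer than `c :: t` and both are suffixes of `lam f`, the node `u` lies above
  -- `c :: t`. All edges at `v` are then in the cone of `u`, and `v` is not in its boundary.
  refine hnf ⟨hf', List.IsSuffix.trans ?_ (hall f' hf' hvf')⟩
  refine List.suffix_of_suffix_length_le huf (hall f hf hvf) ?_
  have := List.IsSuffix.length_le hu
  rw [List.length_tail] at this
  rw [List.length_cons]
  omega

variable [Finite V]

theorem leafTree_adj {a b : (leafTree G lam).node} :
    (leafTree G lam).graph.Adj a b ↔ (∃ c, b.1 = c :: a.1) ∨ ∃ c, a.1 = c :: b.1 := by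
  have key : ∀ s t : List ℕ, (s.tail = t ∧ s ≠ []) ↔ ∃ c, s = c :: t := by
    intro s t
    cases s <;> simp
  change (b.1.tail = a.1 ∧ b.1 ≠ []) ∨ (a.1.tail = b.1 ∧ a.1 ≠ []) ↔ _
  rw [key, key]

theorem leafTree_isChild {a b : (leafTree G lam).node} {c : ℕ} (h : b.1 = c :: a.1) :
    (leafTree G lam).IsChild a b := by
  obtain ⟨b, hb⟩ := b
  obtain ⟨a, ha⟩ := a
  obtain rfl : b = c :: a := h
  exact listTree_isChild c a hb

theorem eq_cons_of_isChild {a b : (leafTree G lam).node} (h : (leafTree G lam).IsChild a b) :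
    ∃ c, b.1 = c :: a.1 := by
  refine (leafTree_adj.1 h.1).resolve_right ?_
  rintro ⟨c, hc⟩
  exact (leafTree_isChild hc).notMem (h.mem_support.2 (.inl (RTree.mem_path_self a)))

theorem suffix_of_mem_path {a b : (leafTree G lam).node}
    (h : a ∈ ((leafTree G lam).path b).support) : a.1 <:+ b.1 :=
  listTree_suffix b.1 b.2 a h

/-- The child of the node `t` in the direction of a leaf. -/
theorem exists_child {t : (leafTree G lam).node} {e : Sym2 V} (he : e ∈ G.edges) {c : ℕ}
    (h : c :: t.1 <:+ lam e) : ∃ s : (leafTree G lam).node, s.1 = c :: t.1 :=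
  ⟨⟨c :: t.1, mem_leafNodes_of_suffix he h⟩, rfl⟩

theorem exists_parent {t : (leafTree G lam).node} (ht : t.1 ≠ []) :
    ∃ (s : (leafTree G lam).node) (c : ℕ), t.1 = c :: s.1 :=
  ⟨⟨t.1.tail, tail_mem_leafNodes _ t.2⟩, t.1.head ht, (List.cons_head_tail ht).symm⟩

/-- The bag `δ(π_t)`. -/
noncomputable def leafBag (G : LoopGraph V) (lam : Sym2 V → List ℕ) (t : List ℕ) : Finset V :=
  (Set.toFinite (G.coneBoundary lam (star t))).toFinset

theorem coe_leafBag (t : List ℕ) : (leafBag G lam t : Set V) = G.coneBoundary lam (star t) := by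
  simp [leafBag]

namespace IsLeafDec

theorem isLeaf_of_forall_notMem (h : IsLeafDec G k q code lam) {t : (leafTree G lam).node}
    {e : Sym2 V} (he : e ∈ G.edges)
    (hn : ∀ s, (leafTree G lam).graph.Adj t s → e ∉ leafCone G lam t.1 s.1) :
    (leafTree G lam).IsLeaf t ∧ t.1 = lam e := by
  have hmem : t.1 <:+ lam e := by
    by_cases ht : t.1 = []
    · rw [ht]; exact List.nil_suffix
    · obtain ⟨p, c, hp⟩ := exists_parent ht
      have := hn p (leafTree_adj.2 (.inr ⟨c, hp⟩))
      rw [leafCone_parent hp] at this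
      by_contra hcon
      exact this ⟨he, fun h => hcon h.2⟩
  have heq : t.1 = lam e := by
    by_contra hne
    obtain ⟨c, hc⟩ := exists_cons_suffix hmem hne
    obtain ⟨s, hs⟩ := exists_child he hc
    refine hn s (leafTree_adj.2 (.inl ⟨c, hs⟩)) ?_
    rw [leafCone_child hs]
    exact ⟨he, hs ▸ hc⟩
  refine ⟨?_, heq⟩
  obtain ⟨p, c, hp⟩ := exists_parent (heq ▸ h.ne_nil he)
  rw [RTree.IsLeaf, Set.ncard_eq_one]
  refine ⟨p, Set.eq_singleton_iff_unique_mem.2 ⟨leafTree_adj.2 (.inr ⟨c, hp⟩), ?_⟩⟩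
  intro s hs
  obtain ⟨a, ha⟩ | ⟨a, ha⟩ := leafTree_adj.1 hs
  · exfalso
    obtain hs0 | ⟨e', he', hs'⟩ := s.2
    · rw [ha] at hs0
      exact List.cons_ne_nil _ _ hs0
    · rw [ha, heq] at hs'
      exact h.not_suffix he he' hs' List.suffix_rfl
  · exact Subtype.ext (List.cons.inj (ha.symm.trans hp)).2

theorem iUnion_partitionAt (h : IsLeafDec G k q code lam) (t : (leafTree G lam).node) :
    ⋃ i, partitionAt G (leafTree G lam) (fun s t => leafCone G lam s.1 t.1) t i = G.edges := by
  ext e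
  rw [Set.mem_iUnion]
  constructor
  · rintro ⟨_ | s, hi⟩
    · simp only [partitionAt] at hi
      split_ifs at hi
      · exact hi.1
      · exact hi.elim
    · exact leafCone_subset _ _ hi
  · intro he
    by_cases hex : ∃ s, (leafTree G lam).graph.Adj t s ∧ e ∈ leafCone G lam t.1 s.1
    · obtain ⟨s, hs, hes⟩ := hex
      exact ⟨some ⟨s, hs⟩, hes⟩
    · push Not at hex
      refine ⟨none, ?_⟩
      simp only [partitionAt, if_pos (h.isLeaf_of_forall_notMem he hex).1]
      refine ⟨he, ?_⟩
      rw [Set.mem_iUnion]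
      rintro ⟨s, hs⟩
      exact hex s s.2 hs

theorem disjoint_leafCone {t s s' : (leafTree G lam).node} (hs : (leafTree G lam).graph.Adj t s)
    (hs' : (leafTree G lam).graph.Adj t s') (hne : s ≠ s') :
    Disjoint (leafCone G lam t.1 s.1) (leafCone G lam t.1 s'.1) := by
  rw [Set.disjoint_left]
  intro e he he'
  obtain ⟨c, hc⟩ | ⟨c, hc⟩ := leafTree_adj.1 hs <;>
    obtain ⟨c', hc'⟩ | ⟨c', hc'⟩ := leafTree_adj.1 hs'
  · rw [leafCone_child hc] at he
    rw [leafCone_child hc'] at he'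
    exact hne (Subtype.ext (eq_of_suffix_of_length he.2 he'.2 (by rw [hc, hc']; rfl)))
  · rw [leafCone_child hc] at he
    rw [leafCone_parent hc'] at he'
    exact he'.2 ⟨he.1, (hc ▸ List.suffix_cons c t.1 : t.1 <:+ s.1).trans he.2⟩
  · rw [leafCone_parent hc] at he
    rw [leafCone_child hc'] at he'
    exact he.2 ⟨he'.1, (hc' ▸ List.suffix_cons c' t.1 : t.1 <:+ s'.1).trans he'.2⟩
  · exact hne (Subtype.ext (List.cons.inj (hc.symm.trans hc')).2)

theorem isPartition (h : IsLeafDec G k q code lam) (t : (leafTree G lam).node) :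
    IsPartition G.edges
      (partitionAt G (leafTree G lam) (fun s t => leafCone G lam s.1 t.1) t) := by
  refine ⟨h.iUnion_partitionAt t, ?_⟩
  have hnone : ∀ s : (leafTree G lam).graph.neighborSet t,
      Disjoint (partitionAt G (leafTree G lam) (fun s t => leafCone G lam s.1 t.1) t none)
        (leafCone G lam t.1 s.1.1) := by
    intro s
    simp only [partitionAt]
    split_ifs
    · exact Set.disjoint_sdiff_left.mono_right (Set.subset_iUnion
        (fun s : (leafTree G lam).graph.neighborSet t => leafCone G lam t.1 s.1.1) s)
    · exact Set.empty_disjoint _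
  rintro (_ | s) (_ | s') hne
  · exact absurd rfl hne
  · exact hnone s'
  · exact (hnone s).symm
  · exact disjoint_leafCone s.2 s'.2 fun heq => hne (congrArg some (Subtype.ext heq))

theorem partitionBoundary_eq (h : IsLeafDec G k q code lam) (t : (leafTree G lam).node) :
    partitionBoundary G (leafTree G lam) (fun s t => leafCone G lam s.1 t.1) t =
      G.coneBoundary lam (star t.1) := by
  have hsome : ∀ s, (leafTree G lam).graph.Adj t s → ∀ v ∈ G.boundary (leafCone G lam t.1 s.1),
      v ∈ G.coneBoundary lam (star t.1) := by
    intro s hs v hv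
    obtain ⟨c, hc⟩ | ⟨c, hc⟩ := leafTree_adj.1 hs
    · rw [leafCone_child hc] at hv
      exact ⟨s.1, .inr (by rw [hc]; rfl), hv⟩
    · rw [leafCone_parent hc, LoopGraph.boundary_compl (cone_subset_edges _)] at hv
      exact ⟨t.1, .inl rfl, hv⟩
  have hP := h.isPartition t
  ext v
  constructor
  · rintro ⟨_ | s, hv⟩
    -- An edge outside the extra part lies in the cone at some neighbour, so the vertex is also in
    -- the boundary of that cone.
    · obtain ⟨e, he, e', ⟨he', hn⟩, hve, hve'⟩ := hv
      have hU := he'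
      rw [← hP.1] at hU
      obtain ⟨_ | s, hs⟩ := Set.mem_iUnion.1 hU
      · exact absurd hs hn
      · have heE : e ∈ G.edges := hP.1 ▸ Set.mem_iUnion.2 ⟨none, he⟩
        refine hsome s s.2 v ⟨e', hs, e, ⟨heE, fun hes => ?_⟩, hve', hve⟩
        exact Set.disjoint_left.1 (hP.2 (Option.some_ne_none s)) hes he
    · exact hsome s s.2 v hv
  · have hself : ∀ v ∈ G.boundary (G.cone lam t.1), v ∈
        partitionBoundary G (leafTree G lam) (fun s t => leafCone G lam s.1 t.1) t := by
      intro v hv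
      by_cases ht : t.1 = []
      · rw [ht, cone_nil, boundary_edges] at hv
        exact hv.elim
      · obtain ⟨p, c, hp⟩ := exists_parent ht
        refine ⟨some ⟨p, leafTree_adj.2 (.inr ⟨c, hp⟩)⟩, ?_⟩
        change v ∈ G.boundary (leafCone G lam t.1 p.1)
        rwa [leafCone_parent hp, LoopGraph.boundary_compl (cone_subset_edges _)]
    rintro ⟨s, rfl | hs, hv⟩
    · exact hself v hv
    · obtain _ | ⟨c, s⟩ := s
      · exact hself v (hs ▸ hv)
      · obtain rfl : s = t.1 := hs
        obtain ⟨e, he, -⟩ := id hv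
        obtain ⟨u, hu⟩ := exists_child he.1 he.2
        refine ⟨some ⟨u, leafTree_adj.2 (.inl ⟨c, hu⟩)⟩, ?_⟩
        change v ∈ G.boundary (leafCone G lam t.1 u.1)
        rwa [leafCone_child hu, hu]

theorem encard_leafCone_le (h : IsLeafDec G k q code lam) {l t : (leafTree G lam).node}
    (hl : (leafTree G lam).IsLeaf l)
    (htl : (leafTree G lam).graph.Adj t l) : (leafCone G lam t.1 l.1).encard ≤ 1 := by
  obtain ⟨p, hp⟩ := Set.ncard_eq_one.1 hl
  have huniq : ∀ s, (leafTree G lam).graph.Adj l s → s = t := by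
    intro s hs
    have h1 : s ∈ (leafTree G lam).graph.neighborSet l := hs
    have h2 : t ∈ (leafTree G lam).graph.neighborSet l := htl.symm
    rw [hp, Set.mem_singleton_iff] at h1 h2
    exact h1.trans h2.symm
  obtain ⟨c, hc⟩ | ⟨c, hc⟩ := leafTree_adj.1 htl
  · rw [leafCone_child hc]
    have key : ∀ e ∈ G.cone lam l.1, l.1 = lam e := by
      intro e he
      by_contra hne
      obtain ⟨a, ha⟩ := exists_cons_suffix he.2 hne
      obtain ⟨s, hs⟩ := exists_child he.1 ha
      have := huniq s (leafTree_adj.2 (.inl ⟨a, hs⟩))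
      subst this
      have := congrArg List.length hc
      simp [hs] at this
      omega
    refine Set.encard_le_one_iff.2 fun e e' he he' => ?_
    exact h.eq_of_suffix e he.1 e' he'.1 (key e he ▸ he'.2)
  · rw [leafCone_parent hc]
    -- The leaf can be the root, namely when it has only one child. Then all edges lie below that
    -- child and the cone towards the root is empty.
    have hl0 : l.1 = [] := by
      by_contra hne
      obtain ⟨p, a, ha⟩ := exists_parent hne
      have := huniq p (leafTree_adj.2 (.inr ⟨a, ha⟩))
      subst this
      have := congrArg List.length hc
      simp [ha] at this
      omega
    suffices H : G.edges \ G.cone lam t.1 = ∅ by simp [H]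
    rw [Set.sdiff_eq_empty]
    intro e he
    have hs := h.singleton_suffix he
    rw [← hl0] at hs
    obtain ⟨s, hs'⟩ := exists_child he hs
    have := huniq s (leafTree_adj.2 (.inl ⟨_, hs'⟩))
    subst this
    exact ⟨he, hs' ▸ hs⟩

theorem leafBag_nil (h : IsLeafDec G k q code lam) : leafBag G lam [] = ∅ := by
  rw [← Finset.coe_eq_empty, coe_leafBag]
  exact Set.subset_empty_iff.1
    (h.coneBoundary_nil ▸ G.coneBoundary_mono lam (star_subset_spine List.suffix_rfl))

theorem exists_root_cone (h : IsLeafDec G k q code lam) (hG : ∀ v, s(v, v) ∈ G.edges)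
    (hcode : Function.Injective code) (C : G.adj.ConnectedComponent) :
    ∃ c, (leafTree G lam).graph.Adj (leafTree G lam).root c ∧
      leafCone G lam (leafTree G lam).root.1 c.1 = G.componentEdges C := by
  induction C using SimpleGraph.ConnectedComponent.ind with
  | _ v =>
  obtain ⟨s, hs⟩ := exists_child (t := (leafTree G lam).root) (hG v) (h.singleton_suffix (hG v))
  refine ⟨s, leafTree_adj.2 (.inl ⟨_, hs⟩), ?_⟩
  rw [leafCone_child hs]
  ext f
  rw [← LoopGraph.mem_escape_empty_loop hG, hs]
  constructor
  · rintro ⟨hf, hsf⟩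
    have := (List.cons.inj (eq_of_suffix_of_length hsf (h.singleton_suffix hf) rfl)).1
    rw [hcode this]
    exact LoopGraph.self_mem_escape hf
  · intro hf
    refine ⟨hf.1, ?_⟩
    rw [← LoopGraph.escape_eq_escape (hG v) hf]
    exact h.singleton_suffix hf.1

theorem isPreTreeDec (h : IsLeafDec G k q code lam) (hG : ∀ v, s(v, v) ∈ G.edges)
    (hcode : Function.Injective code) :
    IsPreTreeDec G (leafTree G lam) (fun t => leafBag G lam t.1)
      (fun s t => leafCone G lam s.1 t.1) where
  root_bag := h.leafBag_nil
  root_cone := h.exists_root_cone hG hcode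
  leaf_cone _ _ hl htl := h.encard_leafCone_le hl htl
  partition := h.isPartition
  boundary_subset t := by rw [h.partitionBoundary_eq t, coe_leafBag]
  disjoint s t hst := by
    obtain ⟨c, hc⟩ | ⟨c, hc⟩ := leafTree_adj.1 hst
    · rw [leafCone_child hc, leafCone_parent hc]
      exact Set.disjoint_sdiff_right
    · rw [leafCone_child hc, leafCone_parent hc]
      exact Set.disjoint_sdiff_left

theorem isExact (h : IsLeafDec G k q code lam) :
    IsExact G (leafTree G lam) (fun t => leafBag G lam t.1)
      (fun s t => leafCone G lam s.1 t.1) where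
  edge_exact s t hst := by
    obtain ⟨c, hc⟩ | ⟨c, hc⟩ := leafTree_adj.1 hst
    · rw [leafCone_child hc, leafCone_parent hc]
      exact Set.union_sdiff_cancel (cone_subset_edges _)
    · rw [leafCone_child hc, leafCone_parent hc]
      exact Set.sdiff_union_of_subset (cone_subset_edges _)
  bag_exact t := by rw [h.partitionBoundary_eq t, coe_leafBag]

end IsLeafDec

variable [DecidableEq V]

/-- By `mem_star_of_mem_spine`, vertices new in a bag relative to the parent have not occurred
higher up, so the summands count disjoint subsets of the spine boundary. -/
theorem placements_leafTree_le (t : (leafTree G lam).node) :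
    placements (leafTree G lam) (fun t => leafBag G lam t.1) t ≤
      (G.coneBoundary lam (spine t.1)).ncard := by
  induction t using RTree.induction_on with
  | root => rw [placements_root]; exact Nat.zero_le _
  | child t s hs ih =>
    rw [placements_child hs]
    obtain ⟨c, hc⟩ := eq_cons_of_isChild hs
    refine (Nat.add_le_add_right ih _).trans ?_
    rw [← Set.ncard_coe_finset, ← Set.ncard_union_eq]
    · refine Set.ncard_le_ncard (Set.union_subset ?_ ?_)
      · exact G.coneBoundary_mono lam (spine_mono (hc ▸ List.suffix_cons _ _))
      · rw [Finset.coe_sdiff, coe_leafBag]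
        exact Set.sdiff_subset.trans (G.coneBoundary_mono lam (star_subset_spine List.suffix_rfl))
    · rw [Set.disjoint_left]
      intro v hv hv'
      rw [Finset.coe_sdiff, coe_leafBag, coe_leafBag, hc] at hv'
      exact hv'.2 (mem_star_of_mem_spine hv'.1 hv)

theorem IsLeafDec.hasExactPreTreeDec (h : IsLeafDec G k q code lam)
    (hG : ∀ v, s(v, v) ∈ G.edges) (hcode : Function.Injective code) :
    HasExactPreTreeDec G k q := by
  refine ⟨leafTree G lam, _, _, h.isPreTreeDec hG hcode, h.isExact, ?_, ?_⟩
  · refine RTree.width_le fun t => ?_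
    rw [← Set.ncard_coe_finset, coe_leafBag]
    exact h.card_star_node t.2
  · refine Finset.sup_le fun t _ => ?_
    exact (placements_leafTree_le t).trans (h.card_spine_node t.2)

end CopsRobber

namespace CopsRobber

variable {V : Type*} {G : LoopGraph V} {k q : ℕ} {code : Set (Sym2 V) → ℕ}
  {lam : Sym2 V → List ℕ}

/-! ### The tree decomposition of a placement of the edges -/

/-- All nodes below the root on this path belong to the component consisting of the single loop,
where nothing is split. -/
theorem IsLeafDec.coneBoundary_isolated (h : IsLeafDec G k q code lam)
    (hcode : Function.Injective code) {v : V} (hv : s(v, v) ∈ G.edges) (hiso : ∀ f ∈ G.edges, v ∈ f → f = s(v, v)) {t : List ℕ}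
    (ht : t <:+ lam s(v, v)) : G.coneBoundary lam (spine t) = ∅ := by
  obtain rfl | ht0 := eq_or_ne t []
  · exact h.coneBoundary_nil
  rw [Set.eq_empty_iff_forall_notMem]
  rintro x ⟨s, hs, hx⟩
  by_cases hs0 : s.tail = []
  · exact Set.eq_empty_iff_forall_notMem.1 h.coneBoundary_nil x ⟨s, hs0 ▸ List.suffix_rfl, hx⟩
  obtain ⟨e, ⟨he, hse⟩, e', ⟨he', hn⟩, hxe, hxe'⟩ := hx
  have key : ∀ f ∈ G.edges, s.tail <:+ lam f → [code (G.escape ∅ f)] <:+ s.tail := fun f hf hsf =>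
    List.suffix_of_suffix_length_le (h.singleton_suffix hf) hsf (List.length_pos_iff.2 hs0)
  have h1 := key e he ((List.tail_suffix s).trans hse)
  have h2 := key _ hv (List.IsSuffix.trans hs ht)
  have h3 : G.escape ∅ e = G.escape ∅ s(v, v) :=
    hcode (List.cons.inj (eq_of_suffix_of_length h1 h2 rfl)).1
  have h4 : G.escape ∅ s(v, v) ⊆ {s(v, v)} := by
    refine LoopGraph.escape_subset_of_boundary ?_ rfl
    rintro w ⟨f, rfl, f', ⟨hf', hne⟩, hw, hw'⟩
    simp only [Sym2.mem_iff, or_self] at hw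
    subst hw
    exact absurd (hiso f' hf' hw') hne
  have h5 : e = s(v, v) := h4 (h3 ▸ LoopGraph.self_mem_escape he)
  subst h5
  simp only [Sym2.mem_iff, or_self] at hxe
  subst hxe
  rw [hiso e' he' hxe'] at hn
  exact hn ⟨he, hse⟩

variable [Finite V]

/-- The bag of a node: the vertices incident to edges in different directions, and, at a leaf, the
ends of its edge. -/
noncomputable def treeBag (G : LoopGraph V) (lam : Sym2 V → List ℕ) (t : List ℕ) : Finset V :=
  (Set.toFinite (G.coneBoundary lam (star t) ∪ {v | ∃ e ∈ G.edges, v ∈ e ∧ lam e = t})).toFinset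

theorem mem_treeBag {t : List ℕ} {v : V} : v ∈ treeBag G lam t ↔
    v ∈ G.coneBoundary lam (star t) ∨ ∃ e ∈ G.edges, v ∈ e ∧ lam e = t := by
  simp [treeBag]

theorem exists_suffix_of_mem_treeBag {t : List ℕ} {v : V} (hv : v ∈ treeBag G lam t) :
    ∃ e ∈ G.edges, v ∈ e ∧ t <:+ lam e := by
  obtain ⟨s, hs, e, he, -, -, hve, -⟩ | ⟨e, he, hve, rfl⟩ := mem_treeBag.1 hv
  · refine ⟨e, he.1, hve, List.IsSuffix.trans ?_ he.2⟩
    obtain rfl | rfl := hs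
    · exact List.suffix_rfl
    · exact List.tail_suffix s
  · exact ⟨e, he, hve, List.suffix_rfl⟩

/-- The nodes whose bags contain `v`. -/
def bagNodes (G : LoopGraph V) (lam : Sym2 V → List ℕ) (v : V) : Set (leafTree G lam).node :=
  {t | v ∈ treeBag G lam t.1}

/-- From any node whose bag contains `v` one gets to the top node of this kind. -/
theorem exists_top {v : V} (t : (leafTree G lam).node) (ht : t ∈ bagNodes G lam v) :
    ∃ m : bagNodes G lam v, (∀ e ∈ G.edges, v ∈ e → m.1.1 <:+ lam e) ∧
      ((leafTree G lam).graph.induce (bagNodes G lam v)).Reachable ⟨t, ht⟩ m := by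
  induction t using RTree.induction_on with
  | root => exact ⟨⟨_, ht⟩, fun _ _ _ => List.nil_suffix, .refl _⟩
  | child t s hts ih =>
    by_cases hall : ∀ e ∈ G.edges, v ∈ e → s.1 <:+ lam e
    · exact ⟨⟨s, ht⟩, hall, .refl _⟩
    push Not at hall
    obtain ⟨e', he', hve', hn⟩ := hall
    obtain ⟨e, he, hve, hs⟩ := exists_suffix_of_mem_treeBag ht
    obtain ⟨c, hc⟩ := eq_cons_of_isChild hts
    have hv' : t ∈ bagNodes G lam v := mem_treeBag.2 <| .inl
      ⟨s.1, .inr (by rw [hc]; rfl), e, ⟨he, hs⟩, e', ⟨he', fun h => hn h.2⟩, hve, hve'⟩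
    obtain ⟨m, htop, hr⟩ := ih hv'
    refine ⟨m, htop, SimpleGraph.Reachable.trans (SimpleGraph.Adj.reachable ?_) hr⟩
    exact hts.1.symm

/-- If `m` were strictly above `m'`, a cone in the star of `m` that meets the edges at `v` would
belong to a node above or equal to `m'`, and so contain all of them without splitting `v`. -/
theorem eq_of_top_of_suffix {v : V} {m m' : List ℕ} (hm : v ∈ treeBag G lam m)
    (hm' : ∀ e ∈ G.edges, v ∈ e → m' <:+ lam e) (h : m <:+ m') : m = m' := by
  by_contra hne
  obtain ⟨c, hc⟩ := exists_cons_suffix h hne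
  have hlen := hc.length_le
  rw [List.length_cons] at hlen
  obtain ⟨s, hs, e, ⟨he, hse⟩, e', ⟨he', hn⟩, hve, hve'⟩ | ⟨e, he, hve, rfl⟩ := mem_treeBag.1 hm
  · refine hn ⟨he', List.IsSuffix.trans ?_ (hm' e' he' hve')⟩
    refine List.suffix_of_suffix_length_le hse (hm' e he hve) ?_
    obtain rfl | rfl := hs
    · exact h.length_le
    · rw [List.length_tail] at hlen; omega
  · have := (hm' e he hve).length_le
    omega

/-- From each node whose bag contains `v` one can climb, inside such nodes, to one above all edges
at `v`; this top node is unique. -/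
theorem treeBag_connected (hG : ∀ v, s(v, v) ∈ G.edges) (v : V) :
    ((leafTree G lam).graph.induce (bagNodes G lam v)).Connected := by
  have hloop : v ∈ treeBag G lam (lam s(v, v)) :=
    mem_treeBag.2 (.inr ⟨_, hG v, Sym2.mem_mk_left _ _, rfl⟩)
  have : Nonempty (bagNodes G lam v) :=
    ⟨⟨⟨_, mem_leafNodes_of_suffix (hG v) List.suffix_rfl⟩, hloop⟩⟩
  refine ⟨?_⟩
  rintro ⟨a, ha⟩ ⟨b, hb⟩
  obtain ⟨m, htop, hr⟩ := exists_top a ha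
  obtain ⟨m', htop', hr'⟩ := exists_top b hb
  obtain rfl : m = m' := by
    have h1 := htop _ (hG v) (Sym2.mem_mk_left _ _)
    have h2 := htop' _ (hG v) (Sym2.mem_mk_left _ _)
    refine Subtype.ext (Subtype.ext ?_)
    obtain h | h := List.suffix_or_suffix_of_suffix h1 h2
    · exact eq_of_top_of_suffix m.2 htop' h
    · exact (eq_of_top_of_suffix m'.2 htop h).symm
  exact hr.trans hr'.symm

namespace IsLeafDec

theorem treeBag_inner (h : IsLeafDec G k q code lam) {e : Sym2 V} (he : e ∈ G.edges) {c : ℕ}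
    {t : List ℕ} (ht : c :: t <:+ lam e) :
    (treeBag G lam t : Set V) ⊆ G.coneBoundary lam (star t) := by
  intro v hv
  refine (mem_treeBag.1 hv).resolve_right ?_
  rintro ⟨e', he', -, rfl⟩
  exact h.not_suffix he' he ht List.suffix_rfl

/-- The bag of a leaf is contained in the bag of its parent, unless its edge is isolated. -/
theorem treeBag_leaf (h : IsLeafDec G k q code lam) (hG : ∀ v, s(v, v) ∈ G.edges)
    (hcode : Function.Injective code) {e : Sym2 V} (he : e ∈ G.edges) {c : ℕ} {t : List ℕ}
    (hl : lam e = c :: t) :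
    (treeBag G lam (lam e) : Set V) ⊆ G.coneBoundary lam (star t) ∨
      (G.coneBoundary lam (spine t) = ∅ ∧ ∃ v, (treeBag G lam (lam e) : Set V) ⊆ {v}) := by
  have hinj : ∀ e' ∈ G.edges, lam e' = lam e → e' = e := fun e' he' heq =>
    h.eq_of_suffix e' he' e he (heq ▸ List.suffix_rfl)
  obtain ⟨v, rfl, hiso⟩ | hn := LoopGraph.isolated_or hG e
  · refine .inr ⟨h.coneBoundary_isolated hcode he hiso (hl ▸ List.suffix_cons c t), v, ?_⟩
    intro w hw
    obtain hw | ⟨e', he', hwe', heq⟩ := mem_treeBag.1 hw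
    · have := G.coneBoundary_mono lam (star_subset_spine List.suffix_rfl) hw
      rw [h.coneBoundary_isolated hcode he hiso List.suffix_rfl] at this
      exact this.elim
    · rw [hinj e' he' heq] at hwe'
      simpa using hwe'
  · refine .inl fun w hw => ?_
    obtain hw | ⟨e', he', hwe', heq⟩ := mem_treeBag.1 hw
    · exact h.coneBoundary_star_leaf he hl hw
    · rw [hinj e' he' heq] at hwe'
      obtain ⟨f, hf, hfe, hwf⟩ := hn w hwe'
      refine ⟨lam e, .inr (by rw [hl]; rfl), e, ⟨he, List.suffix_rfl⟩, f, ⟨hf, fun hc => ?_⟩,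
        hwe', hwf⟩
      exact hfe (h.eq_of_suffix e he f hf hc.2).symm

theorem card_treeBag_le (h : IsLeafDec G k q code lam) (hG : ∀ v, s(v, v) ∈ G.edges)
    (hcode : Function.Injective code) (hk : 1 ≤ k) {t : List ℕ} (ht : t ∈ leafNodes G lam) :
    (treeBag G lam t).card ≤ k := by
  rw [← Set.ncard_coe_finset]
  obtain ⟨e, he, rfl⟩ | ⟨e, he, c, hs⟩ | hE := leafNodes_cases ht
  · obtain ⟨c, t, hl⟩ := List.exists_cons_of_ne_nil (h.ne_nil he)
    obtain hsub | ⟨-, v, hsub⟩ := h.treeBag_leaf hG hcode he hl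
    · exact (Set.ncard_le_ncard hsub).trans (h.card_star e he c t (hl ▸ List.suffix_rfl))
    · refine (Set.ncard_le_ncard hsub).trans ?_
      rwa [Set.ncard_singleton]
  · exact (Set.ncard_le_ncard (h.treeBag_inner he hs)).trans (h.card_star e he c t hs)
  · have hsub : (treeBag G lam t : Set V) ⊆ ∅ := fun v _ => by simpa [hE] using hG v
    simp [Set.subset_empty_iff.1 hsub]

/-- Path unions lie in the spine boundary, except at the leaf of an isolated loop. There the spine
is empty, the union has at most one vertex, and `1 ≤ q` suffices. -/
theorem ncard_pathBags_le (h : IsLeafDec G k q code lam) (hG : ∀ v, s(v, v) ∈ G.edges)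
    (hcode : Function.Injective code) (hq : 1 ≤ q) {t : List ℕ} (ht : t ∈ leafNodes G lam) :
    {v | ∃ u, u <:+ t ∧ v ∈ treeBag G lam u}.ncard ≤ q := by
  have hinner : ∀ e ∈ G.edges, ∀ c t, c :: t <:+ lam e →
      ∀ u, u <:+ t → ∀ v ∈ treeBag G lam u, v ∈ G.coneBoundary lam (spine t) := by
    intro e he c t hs u hu v hv
    by_cases hut : u = t
    · subst hut
      exact G.coneBoundary_mono lam (star_subset_spine hu) (h.treeBag_inner he hs hv)
    · obtain ⟨a, ha⟩ := exists_cons_suffix hu hut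
      exact G.coneBoundary_mono lam (star_subset_spine hu)
        (h.treeBag_inner he (ha.trans ((List.suffix_cons c t).trans hs)) hv)
  obtain ⟨e, he, rfl⟩ | ⟨e, he, c, hs⟩ | hE := leafNodes_cases ht
  · obtain ⟨c, t, hl⟩ := List.exists_cons_of_ne_nil (h.ne_nil he)
    have hcases : ∀ u, u <:+ lam e → u = lam e ∨ u <:+ t := by
      intro u hu
      rwa [hl, List.suffix_cons_iff, ← hl] at hu
    have hs : c :: t <:+ lam e := hl ▸ List.suffix_rfl
    obtain hsub | ⟨hemp, v, hsub⟩ := h.treeBag_leaf hG hcode he hl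
    · refine (Set.ncard_le_ncard ?_).trans (h.card_spine e he c t hs)
      rintro v ⟨u, hu, hv⟩
      obtain rfl | hu := hcases u hu
      · exact G.coneBoundary_mono lam (star_subset_spine List.suffix_rfl) (hsub hv)
      · exact hinner e he c t hs u hu v hv
    · refine (Set.ncard_le_ncard (t := {v}) ?_).trans (by rwa [Set.ncard_singleton])
      rintro w ⟨u, hu, hw⟩
      obtain rfl | hu := hcases u hu
      · exact hsub hw
      · have := hinner e he c t hs u hu w hw
        rw [hemp] at this
        exact this.elim
  · refine (Set.ncard_le_ncard ?_).trans (h.card_spine e he c t hs)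
    rintro v ⟨u, hu, hv⟩
    exact hinner e he c t hs u hu v hv
  · have : {v | ∃ u, u <:+ t ∧ v ∈ treeBag G lam u} = ∅ :=
      Set.eq_empty_iff_forall_notMem.2 fun v _ => by simpa [hE] using hG v
    simp [this]

theorem hasTreeDec [DecidableEq V] (h : IsLeafDec G k q code lam) (hG : ∀ v, s(v, v) ∈ G.edges)
    (hcode : Function.Injective code) (hk : 1 ≤ k) (hq : 1 ≤ q) : HasTreeDec G k q := by
  refine ⟨leafTree G lam, fun t => treeBag G lam t.1, ⟨?_, ?_, treeBag_connected hG⟩, ?_, ?_⟩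
  · exact fun v => ⟨⟨_, mem_leafNodes_of_suffix (hG v) List.suffix_rfl⟩,
      mem_treeBag.2 (.inr ⟨_, hG v, Sym2.mem_mk_left _ _, rfl⟩)⟩
  · exact fun e he => ⟨⟨_, mem_leafNodes_of_suffix he List.suffix_rfl⟩,
      fun v hv => mem_treeBag.2 (.inr ⟨e, he, hv, rfl⟩)⟩
  · exact RTree.width_le fun t => h.card_treeBag_le hG hcode hk t.2
  · refine Finset.sup_le fun t _ => ?_
    refine le_trans ?_ (h.ncard_pathBags_le hG hcode hq t.2)
    rw [← Set.ncard_coe_finset]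
    refine Set.ncard_le_ncard fun v hv => ?_
    obtain ⟨u, hu, hv⟩ := mem_pathBags.1 hv
    exact ⟨u.1, suffix_of_mem_path hu, hv⟩

end IsLeafDec

theorem exists_code (V : Type*) [Finite V] : 
    ∃ code : Set (Sym2 V) → ℕ, Function.Injective code := by
  have : Countable (Set (Sym2 V)) := Finite.to_countable
  exact Countable.exists_injective_nat _

end CopsRobber

theorem mainTheorem1 {V : Type*} [Fintype V] [DecidableEq V]
    (G : CopsRobber.LoopGraph V) (k q : ℕ) (hk : 1 ≤ k) (hq : 1 ≤ q) :
    List.TFAE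
      [CopsRobber.HasTreeDec G k q,
       CopsRobber.HasTreeDec G.addLoops k q,
       CopsRobber.HasExactPreTreeDec G.addLoops k q,
       CopsRobber.CopsWinMonotone G.addLoops k q,
       CopsRobber.CopsWin G.addLoops k q,
       CopsRobber.CopsWinMonotone G k q,
       CopsRobber.CopsWin G k q] := by
  have hG := G.loop_mem_addLoops
  obtain ⟨code, hcode⟩ := CopsRobber.exists_code V
  tfae_have 1 ↔ 2 := CopsRobber.hasTreeDec_addLoops.symm
  tfae_have 1 → 6 := CopsRobber.HasTreeDec.copsWinMonotone
  tfae_have 2 → 4 := CopsRobber.HasTreeDec.copsWinMonotone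
  tfae_have 6 → 7 := CopsRobber.CopsWinMonotone.copsWin
  tfae_have 4 → 5 := CopsRobber.CopsWinMonotone.copsWin
  tfae_have 7 → 5 := CopsRobber.CopsWin.addLoops hk hq
  tfae_have 3 → 5 := CopsRobber.HasExactPreTreeDec.copsWin hG hk hq
  tfae_have 5 → 2 := fun h =>
    let ⟨_, hlam⟩ := h.exists_isLeafDec hG hcode
    hlam.hasTreeDec hG hcode hk hq
  tfae_have 5 → 3 := fun h =>
    let ⟨_, hlam⟩ := h.exists_isLeafDec hG hcode
    hlam.hasExactPreTreeDec hG hcode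
  tfae_finish
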